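/- **Theorem 2 (Eigenstate filtering).** An $(m+n)$-qubit unitary $U$ is an $(\alpha,m,\epsilon)$-block-encoding of an $n$-qubit operator $A$ if $\|A-\alpha(\langle 0^m|\otimes I)\,U\,(|0^m\rangle\otimes I)\|\le\epsilon$ in the operator norm. There is an absolute constant $C>0$ such that the following holds for all integers $n,m\ge 0$ and all real $\alpha>0$, $\Delta>0$, $\lambda$ and $0<\epsilon\le 1/2$. There is a quantum circuit on $m+2+n$ qubits, determined by $n,m,\alpha,\lambda,\Delta,\epsilon$, consisting of at most $C\,\frac{\alpha}{\Delta}\log\frac1\epsilon$ applications of an $(m+n)$-qubit oracle unitary, its adjoint, or their controlled versions, and of at most $C\,\frac{(m+1)\alpha}{\Delta}\log\frac1\epsilon$ other primitive (one- and two-qubit) gates, such that: whenever $H$ is a Hermitian matrix on $n$ qubits, $U_H$ is an $(\alpha,m,0)$-block-encoding of $H$, and $\lambda$ is an eigenvalue of $H$ separated from the rest of the spectrum of $H$ by a gap $\Delta$ (that is, $|\nu-\lambda|\ge\Delta$ for every eigenvalue $\nu\ne\lambda$ of $H$), the circuit with oracle $U_H$ implements a $(1,m+2,\epsilon)$-block-encoding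 of $P_\lambda$, the orthogonal projector onto the $\lambda$-eigenspace of $H$. -/

import Mathlib

/-- Operators (matrices in the computational basis) on a register of qubits labelled by `W`.
A computational basis state is a bit string `W → Bool`, with `false` for `|0⟩` and `true`
for `|1⟩`. -/
abbrev QOp (W : Type) : Type := Matrix (W → Bool) (W → Bool) ℂ

/-- The wires of a register consisting of `m` ancilla qubits followed by `n` system qubits. -/
abbrev Wires (m n : ℕ) : Type := Fin m ⊕ Fin n

/-- The `n`-qubit operator `(⟨0^m| ⊗ I) U (|0^m⟩ ⊗ I)`. -/
def zeroBlock {m n : ℕ} (U : QOp (Wires m n)) : QOp (Fin n) :=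
  fun x y => U (Sum.elim (fun _ => false) x) (Sum.elim (fun _ => false) y)

open scoped Matrix.Norms.L2Operator in
/-- `U` is an `(α, m, ε)`-block-encoding of the `n`-qubit operator `A`: it is a unitary on
`m + n` qubits with `‖A - α (⟨0^m| ⊗ I) U (|0^m⟩ ⊗ I)‖ ≤ ε` in the operator norm. -/
def IsBlockEncoding {n : ℕ} (α : ℝ) (m : ℕ) (ε : ℝ) (U : QOp (Wires m n)) (A : QOp (Fin n)) :
    Prop :=
  U ∈ Matrix.unitaryGroup (Wires m n → Bool) ℂ ∧ ‖A - (α : ℂ) • zeroBlock U‖ ≤ ε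

open Classical in
/-- The operator on the register `W` that applies `A` to the wires `e k`, `k : κ`, and the
identity to all other wires. -/
noncomputable def applyOn {κ W : Type} (e : κ ↪ W) (A : QOp κ) : QOp W :=
  fun x y => if ∀ w, w ∉ Set.range e → x w = y w then A (x ∘ e) (y ∘ e) else 0

/-- The operator on the register `W` that applies `A` to the wires `e k`, `k : κ`, if the
control wire `c` is in state `|1⟩`, and the identity if it is in state `|0⟩`. It is used only
for a wire `c` outside the range of `e`. -/
noncomputable def applyControlledOn {κ W : Type} [Fintype W] [DecidableEq W]
    (c : W) (e : κ ↪ W) (A : QOp κ) : QOp W :=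
  fun x y => if x c = true then applyOn e A x y else (1 : QOp W) x y

/-- One step of a circuit on the wires `W` that has access to an oracle on a `κ`-labelled
register. The steps are: an arbitrary one- or two-qubit unitary gate on distinct wires; the
oracle (`inv = false`) or its adjoint (`inv = true`) on distinct wires; and the same
controlled by a further wire. -/
inductive CircuitStep (κ W : Type) : Type
  | gate (k : ℕ) (hk : k = 1 ∨ k = 2) (e : Fin k ↪ W)
      (u : Matrix.unitaryGroup (Fin k → Bool) ℂ) : CircuitStep κ W
  | query (inv : Bool) (e : κ ↪ W) : CircuitStep κ W
  | controlledQuery (inv : Bool) (c : W) (e : κ ↪ W) (hc : c ∉ Set.range e) : CircuitStep κ W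

namespace CircuitStep

/-- Whether a step is a query to the (controlled) oracle or its adjoint. -/
def isQuery {κ W : Type} : CircuitStep κ W → Bool
  | gate _ _ _ _ => false
  | query _ _ => true
  | controlledQuery _ _ _ _ => true

/-- The operator performed by a step when the oracle is `U`. -/
noncomputable def eval {κ W : Type} [Fintype W] [DecidableEq W] (U : QOp κ) :
    CircuitStep κ W → QOp W
  | gate _ _ e u => applyOn e (u : Matrix _ _ ℂ)
  | query inv e => applyOn e (if inv then U.conjTranspose else U)
  | controlledQuery inv c e _ => applyControlledOn c e (if inv then U.conjTranspose else U)

end CircuitStep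

/-- An oracle circuit: a finite list of steps, performed from left to right. The oracle itself
is not part of the circuit. -/
abbrev OracleCircuit (κ W : Type) : Type := List (CircuitStep κ W)

namespace OracleCircuit

/-- The operator performed by a circuit when the oracle is `U`. -/
noncomputable def eval {κ W : Type} [Fintype W] [DecidableEq W] (U : QOp κ) :
    OracleCircuit κ W → QOp W
  | [] => 1
  | s :: c => eval U c * s.eval U

/-- The number of applications of the oracle, the controlled oracle, and their adjoints. -/
def queryCount {κ W : Type} (c : OracleCircuit κ W) : ℕ :=
  c.countP fun s => s.isQuery

/-- The number of one- and two-qubit gates. -/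
def gateCount {κ W : Type} (c : OracleCircuit κ W) : ℕ :=
  c.countP fun s => !s.isQuery

end OracleCircuit

/-- The spectral projector `P_μ` of `H`: the orthogonal projection onto the `μ`-eigenspace. -/
noncomputable def spectralProjector {n : ℕ} (H : QOp (Fin n)) (μ : ℝ) : QOp (Fin n) :=
  (Matrix.toEuclideanCLM (n := Fin n → Bool) (𝕜 := ℂ)).symm
    (Module.End.eigenspace (Matrix.toEuclideanLin H) (μ : ℂ)).starProjection

/-- `μ` is an eigenvalue of the Hermitian operator `H` that is separated from the rest of the
spectrum by a gap (at least) `Δ`. -/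
def IsGappedEigenvalue {n : ℕ} (H : QOp (Fin n)) (μ Δ : ℝ) : Prop :=
  μ ∈ spectrum ℝ H ∧ ∀ ν ∈ spectrum ℝ H, ν ≠ μ → Δ ≤ |ν - μ|

/-!
Eigenstate filtering by quantum signal processing.

*Encoding the shifted operator.* One ancilla qubit controls the oracle and is rotated before and
after (`zeroBlock_eval_lcuCircuit`). This block-encodes `h = (H - μ) / (α + |μ|)`, whose eigenvalue
of interest is `0`, and whose other eigenvalues have modulus at least `Δ / (2 α)`.

*Qubitization.* Let `V` perform this encoding and let `Z` flip the sign of the states whose ancillas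
are all zero. The walk operator `T = Z V⁻¹ Z V` satisfies `(T + T⁻¹) J = J (4 h² - 2)` for the
isometry `J = |0⟩ ⊗ I` (`walk_relations`). So the compression of `T ^ k` is a Chebyshev polynomial of
`2 h² - 1`, and on an eigenvector of `h` with eigenvalue `cos (φ / 2)` the compression of `p(T)` is
the mean of `p` at `e^{iφ}` and `e^{-iφ}` (`compression_aeval_mulVec`).

*Filtering.* The polynomial `p` is a power of a normalized Dirichlet kernel centred at `-1`, which is
where the eigenvalue `0` of `h` is found. A kernel of length about `4 α / Δ` is at most `1 / 2` on the
rest of the spectrum, and about `log₂ (1 / ε)` factors bring this below `ε`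
(`norm_filter_error_le`).

*Signal processing.* After a slight damping `|p| < 1` on the unit circle, so by the Fejér–Riesz
theorem `p` has a complement `q` with `|p|² + |q|² = 1` (`Polynomial.exists_complement`). Such a pair
is the first column of a product of `2 × 2` rotations interleaved with `diag(X, 1)`
(`exists_qspColumn_eq`). A second ancilla qubit carries these rotations and controls the walk.

*Gate count.* The only gate that is not local is the reflection `Z`, a phase conditioned on `m + 2`
qubits. All ancillas take part in it, so a system qubit is borrowed, and the controls serve as
borrowed qubits for each other in two Toffoli ladders. This takes linearly many gates
(`OracleCircuit.exists_nonePhase`).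
-/

/-! ### Operators on registers of qubits -/

section Registers

variable {κ W : Type}

theorem extend_comp_embedding (e : κ ↪ W) (u : κ → Bool) (x : W → Bool) :
    Function.extend e u x ∘ e = u := by
  funext k
  simp [e.injective.extend_apply]

theorem extend_eq_of_eqOn_compl (e : κ ↪ W) {x y : W → Bool}
    (h : ∀ w, w ∉ Set.range e → x w = y w) : Function.extend e (y ∘ e) x = y := by
  funext w
  by_cases hw : w ∈ Set.range e
  · obtain ⟨k, rfl⟩ := hw
    simp [e.injective.extend_apply]
  · rw [Function.extend_apply' _ _ _ hw]
    exact h w hw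

theorem applyOn_mul [Fintype κ] [Fintype W] [DecidableEq κ] [DecidableEq W] (e : κ ↪ W)
    (A B : QOp κ) :
    applyOn e (A * B) = applyOn e A * applyOn e B := by
  ext x y
  rw [Matrix.mul_apply]
  have key : ∑ u : κ → Bool, (if ∀ w, w ∉ Set.range e → x w = y w then
      A (x ∘ e) u * B u (y ∘ e) else 0) = ∑ z, applyOn e A x z * applyOn e B z y := by
    refine Fintype.sum_of_injective (fun u => Function.extend e u x) ?_ _ _ ?_ ?_
    · intro u v huv
      rw [← extend_comp_embedding e u x, ← extend_comp_embedding e v x]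
      exact congrArg (· ∘ e) huv
    · intro z hz
      have : ¬ ∀ w, w ∉ Set.range e → x w = z w := fun h =>
        hz ⟨z ∘ e, extend_eq_of_eqOn_compl e h⟩
      simp only [applyOn, if_neg this, zero_mul]
    · intro u
      have h1 : ∀ w, w ∉ Set.range e → x w = Function.extend e u x w := fun w hw =>
        (Function.extend_apply' _ _ _ hw).symm
      have h2 : (∀ w, w ∉ Set.range e → Function.extend e u x w = y w) ↔
          ∀ w, w ∉ Set.range e → x w = y w :=
        forall₂_congr fun w hw => by rw [← h1 w hw]
      simp only [applyOn, if_pos h1, extend_comp_embedding, h2, mul_ite, mul_zero]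
  rw [← key]
  by_cases h : ∀ w, w ∉ Set.range e → x w = y w
  · simp only [applyOn, if_pos h, Matrix.mul_apply]
  · simp only [applyOn, if_neg h, Finset.sum_const_zero]

theorem applyOn_one [DecidableEq κ] [DecidableEq W] [Fintype κ] [Fintype W] (e : κ ↪ W) :
    applyOn e (1 : QOp κ) = 1 := by
  ext x y
  by_cases hxy : x = y
  · subst hxy
    simp [applyOn]
  · rw [Matrix.one_apply_ne hxy]
    unfold applyOn
    split_ifs with h
    · refine Matrix.one_apply_ne fun h' => hxy ?_
      rw [← extend_eq_of_eqOn_compl e h, ← h']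
      exact (extend_eq_of_eqOn_compl e fun _ _ => rfl).symm
    · rfl

theorem applyOn_conjTranspose (e : κ ↪ W) (A : QOp κ) :
    applyOn e A.conjTranspose = (applyOn e A).conjTranspose := by
  ext x y
  simp only [applyOn, Matrix.conjTranspose_apply]
  have : (∀ w, w ∉ Set.range e → x w = y w) ↔ ∀ w, w ∉ Set.range e → y w = x w :=
    forall₂_congr fun w _ => eq_comm
  by_cases h : ∀ w, w ∉ Set.range e → y w = x w
  · rw [if_pos (this.2 h), if_pos h]
  · rw [if_neg fun h' => h (this.1 h'), if_neg h, star_zero]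

theorem eq_update_of_eqOn_ne [DecidableEq W] {t : W} {x y : W → Bool} (h : ∀ w, w ≠ t → x w = y w) :
    y = Function.update x t (y t) := by
  funext w
  by_cases hw : w = t
  · subst hw; simp
  · rw [Function.update_of_ne hw, h w hw]

variable [Fintype W] [DecidableEq W]

theorem applyOn_mem_unitaryGroup [Fintype κ] [DecidableEq κ] (e : κ ↪ W) {A : QOp κ}
    (hA : A ∈ Matrix.unitaryGroup (κ → Bool) ℂ) :
    applyOn e A ∈ Matrix.unitaryGroup (W → Bool) ℂ := by
  rw [Matrix.mem_unitaryGroup_iff'] at hA ⊢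
  rw [Matrix.star_eq_conjTranspose] at hA ⊢
  rw [← applyOn_conjTranspose, ← applyOn_mul, hA, applyOn_one]

/-- The operator that applies to the wire `t` the `2 × 2` matrix `g x`, where `x` is the current
basis state. It is meaningful when `g x` depends only on the wires other than `t`. -/
def condOp (t : W) (g : (W → Bool) → Matrix Bool Bool ℂ) : QOp W :=
  fun x y => if ∀ w, w ≠ t → x w = y w then g x (x t) (y t) else 0

theorem condOp_mul_apply (t : W) (g : (W → Bool) → Matrix Bool Bool ℂ) (M : QOp W)
    (x y : W → Bool) :
    (condOp t g * M) x y = ∑ b, g x (x t) b * M (Function.update x t b) y := by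
  rw [Matrix.mul_apply]
  symm
  refine Fintype.sum_of_injective (fun b => Function.update x t b) ?_ _ _ ?_ ?_
  · exact Function.update_injective x t
  · intro z hz
    have : ¬ ∀ w, w ≠ t → x w = z w := fun h => hz ⟨z t, (eq_update_of_eqOn_ne h).symm⟩
    simp only [condOp, if_neg this, zero_mul]
  · intro b
    have : ∀ w, w ≠ t → x w = Function.update x t b w := fun w hw => by
      rw [Function.update_of_ne hw]
    simp only [condOp, if_pos this, Function.update_self]

theorem mul_condOp_apply (t : W) {g : (W → Bool) → Matrix Bool Bool ℂ}
    (hg : ∀ x b, g (Function.update x t b) = g x) (M : QOp W) (x y : W → Bool) :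
    (M * condOp t g) x y = ∑ b, M x (Function.update y t b) * g y b (y t) := by
  rw [Matrix.mul_apply]
  symm
  refine Fintype.sum_of_injective (fun b => Function.update y t b) ?_ _ _ ?_ ?_
  · exact Function.update_injective y t
  · intro z hz
    have : ¬ ∀ w, w ≠ t → z w = y w := fun h =>
      hz ⟨z t, (eq_update_of_eqOn_ne fun w hw => (h w hw).symm).symm⟩
    simp only [condOp, if_neg this, mul_zero]
  · intro b
    have : ∀ w, w ≠ t → Function.update y t b w = y w := fun w hw => by
      rw [Function.update_of_ne hw]
    simp only [condOp, if_pos this, Function.update_self, hg]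

theorem condOp_mul_condOp (t : W) (g : (W → Bool) → Matrix Bool Bool ℂ)
    {g' : (W → Bool) → Matrix Bool Bool ℂ} (hg' : ∀ x b, g' (Function.update x t b) = g' x) :
    condOp t g * condOp t g' = condOp t fun x => g x * g' x := by
  ext x y
  rw [condOp_mul_apply]
  have (b : Bool) : (∀ w, w ≠ t → Function.update x t b w = y w) ↔
      ∀ w, w ≠ t → x w = y w :=
    forall₂_congr fun w hw => by rw [Function.update_of_ne hw]
  by_cases h : ∀ w, w ≠ t → x w = y w
  · simp only [condOp, this, if_pos h, Matrix.mul_apply, hg', Function.update_self]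
  · simp only [condOp, this, if_neg h, mul_zero, Finset.sum_const_zero]

theorem condOp_one (t : W) : condOp t (fun _ => 1) = (1 : QOp W) := by
  ext x y
  by_cases h : ∀ w, w ≠ t → x w = y w
  · simp only [condOp, if_pos h, Matrix.one_apply]
    congr 1
    refine propext ⟨fun ht => funext fun w => ?_, fun h => congrFun h t⟩
    by_cases hw : w = t
    · rw [hw, ht]
    · exact h w hw
  · simp only [condOp, if_neg h]
    exact (Matrix.one_apply_ne fun hxy => h fun w _ => congrFun hxy w).symm

theorem condOp_conjTranspose (t : W) {g : (W → Bool) → Matrix Bool Bool ℂ}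
    (hg : ∀ x b, g (Function.update x t b) = g x) :
    (condOp t g).conjTranspose = condOp t fun x => (g x).conjTranspose := by
  ext x y
  have : (∀ w, w ≠ t → x w = y w) ↔ ∀ w, w ≠ t → y w = x w :=
    forall₂_congr fun w _ => eq_comm
  by_cases h : ∀ w, w ≠ t → y w = x w
  · have hxy : g x = g y := by
      rw [eq_update_of_eqOn_ne h, hg]
    simp only [condOp, Matrix.conjTranspose_apply, this, if_pos h, hxy]
  · simp only [condOp, Matrix.conjTranspose_apply, this, if_neg h, star_zero]

theorem condOp_mem_unitaryGroup (t : W) {g : (W → Bool) → Matrix Bool Bool ℂ}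
    (hg : ∀ x b, g (Function.update x t b) = g x)
    (hu : ∀ x, g x ∈ Matrix.unitaryGroup Bool ℂ) :
    condOp t g ∈ Matrix.unitaryGroup (W → Bool) ℂ := by
  simp only [Matrix.mem_unitaryGroup_iff', Matrix.star_eq_conjTranspose] at hu ⊢
  rw [condOp_conjTranspose t hg, condOp_mul_condOp t _ hg]
  simp only [hu, condOp_one]

theorem applyOn_condOp [Fintype κ] [DecidableEq κ] (e : κ ↪ W) (i : κ)
    (g : (κ → Bool) → Matrix Bool Bool ℂ) :
    applyOn e (condOp i g) = condOp (e i) fun x => g (x ∘ e) := by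
  ext x y
  have : (∀ w, w ≠ e i → x w = y w) ↔
      (∀ w, w ∉ Set.range e → x w = y w) ∧ ∀ k, k ≠ i → (x ∘ e) k = (y ∘ e) k := by
    refine ⟨fun h => ⟨fun w hw => h w fun h' => hw ⟨i, h'.symm⟩,
      fun k hk => h _ fun h' => hk (e.injective h')⟩, fun h w hw => ?_⟩
    by_cases hr : w ∈ Set.range e
    · obtain ⟨k, rfl⟩ := hr
      exact h.2 k fun h' => hw (by rw [h'])
    · exact h.1 w hr
  by_cases h : ∀ w, w ≠ e i → x w = y w
  · rw [applyOn, if_pos (this.1 h).1, condOp, if_pos (this.1 h).2, condOp, if_pos h]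
    rfl
  · rw [condOp, if_neg h, applyOn]
    split_ifs with h'
    · exact if_neg fun h'' => h (this.2 ⟨h', h''⟩)
    · rfl

/-- The diagonal operator with entry `-1` on the basis states satisfying `f` and `1` on the
others. -/
def phaseOp (f : (W → Bool) → Bool) : QOp W :=
  Matrix.diagonal fun x => if f x then -1 else 1

theorem phaseOp_mul_phaseOp (f f' : (W → Bool) → Bool) :
    phaseOp f * phaseOp f' = phaseOp fun x => f x ^^ f' x := by
  rw [phaseOp, phaseOp, phaseOp, Matrix.diagonal_mul_diagonal]
  congr 1
  funext x
  cases f x <;> cases f' x <;> simp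

/-- `M` is supported on the entries `(x, σ x)`: up to phases, `M` permutes the basis states. -/
def IsMonomial (M : QOp W) (σ : (W → Bool) → (W → Bool)) : Prop :=
  ∀ x y, M x y ≠ 0 → y = σ x

theorem IsMonomial.mul {M M' : QOp W} {σ σ' : (W → Bool) → (W → Bool)}
    (h : IsMonomial M σ) (h' : IsMonomial M' σ') : IsMonomial (M * M') (σ' ∘ σ) := by
  intro x y hxy
  rw [Matrix.mul_apply] at hxy
  obtain ⟨z, -, hz⟩ := Finset.exists_ne_zero_of_sum_ne_zero hxy
  have hz' := mul_ne_zero_iff.1 hz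
  rw [h' z y hz'.2, h x z hz'.1, Function.comp_apply]

/-- Conjugation by a monomial unitary relabels the basis states of a diagonal operator, whatever
the phases of the monomial unitary. -/
theorem IsMonomial.mul_phaseOp_mul_conjTranspose {M : QOp W} {σ : (W → Bool) → (W → Bool)}
    (h : IsMonomial M σ) (hM : M ∈ Matrix.unitaryGroup (W → Bool) ℂ) (f : (W → Bool) → Bool) :
    M * phaseOp f * M.conjTranspose = phaseOp (f ∘ σ) := by
  have h1 : M * phaseOp f = phaseOp (f ∘ σ) * M := by
    ext x y
    rw [phaseOp, phaseOp, Matrix.mul_diagonal, Matrix.diagonal_mul]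
    by_cases hxy : M x y = 0
    · simp [hxy]
    · rw [h x y hxy, mul_comm, Function.comp_apply]
  rw [Matrix.mem_unitaryGroup_iff, Matrix.star_eq_conjTranspose] at hM
  rw [h1, Matrix.mul_assoc, hM, Matrix.mul_one]

theorem commute_condOp_const (t : W) (G : Matrix Bool Bool ℂ) {M : QOp W}
    (h0 : ∀ x y, x t ≠ y t → M x y = 0)
    (h1 : ∀ x y b, x t = y t → M (Function.update x t b) (Function.update y t b) = M x y) :
    Commute (condOp t fun _ => G) M := by
  ext x y
  rw [condOp_mul_apply, mul_condOp_apply t (fun _ _ => rfl)]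
  rw [Finset.sum_eq_single (y t), Finset.sum_eq_single (x t)]
  · rw [mul_comm]
    congr 1
    have := h1 x (Function.update y t (x t)) (y t) (by simp)
    rw [Function.update_idem, Function.update_eq_self] at this
    exact this
  · intro b _ hb
    rw [h0 _ _ (by simpa using hb.symm), zero_mul]
  · simp
  · intro b _ hb
    rw [h0 _ _ (by simpa using hb), mul_zero]
  · simp

end Registers

/-! ### Circuits: gates on one and two wires, inverses, unitarity -/

namespace CircuitStep

variable {κ W : Type}

/-- The one-qubit gate `G` on the wire `w`. -/
def oneGate (w : W) (G : Matrix.unitaryGroup Bool ℂ) : CircuitStep κ W :=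
  gate 1 (Or.inl rfl) ⟨fun _ => w, fun _ _ _ => Subsingleton.elim _ _⟩
    ⟨condOp 0 fun _ => G, condOp_mem_unitaryGroup _ (fun _ _ => rfl) fun _ => G.2⟩

/-- The two-qubit gate that applies `G` to the wire `t` if the wire `c` is in state `|1⟩`. -/
def controlledGate (c t : W) (h : c ≠ t) (G : Matrix.unitaryGroup Bool ℂ) : CircuitStep κ W :=
  gate 2 (Or.inr rfl) ⟨![c, t], by
      intro i j hij
      fin_cases i <;> fin_cases j <;> simp_all⟩
    ⟨condOp 1 fun x => if x 0 = true then G else 1,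
      condOp_mem_unitaryGroup _ (fun x b => by simp) fun x => by
        split_ifs
        · exact G.2
        · exact one_mem _⟩

/-- The step that undoes a given step. -/
def inverse : CircuitStep κ W → CircuitStep κ W
  | gate k hk e u => gate k hk e u⁻¹
  | query inv e => query (!inv) e
  | controlledQuery inv c e hc => controlledQuery (!inv) c e hc

theorem isQuery_inverse (s : CircuitStep κ W) : s.inverse.isQuery = s.isQuery := by
  cases s <;> rfl

variable [Fintype W] [DecidableEq W]

theorem eval_oneGate (U : QOp κ) (w : W) (G : Matrix.unitaryGroup Bool ℂ) :
    (oneGate w G : CircuitStep κ W).eval U = condOp w fun _ => (G : Matrix Bool Bool ℂ) := by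
  simp only [oneGate, eval]
  rw [applyOn_condOp]
  rfl

theorem eval_controlledGate (U : QOp κ) (c t : W) (h : c ≠ t) (G : Matrix.unitaryGroup Bool ℂ) :
    (controlledGate c t h G : CircuitStep κ W).eval U =
      condOp t fun x => if x c = true then (G : Matrix Bool Bool ℂ) else 1 := by
  simp only [controlledGate, eval]
  rw [applyOn_condOp]
  rfl

theorem applyControlledOn_mul [Fintype κ] [DecidableEq κ] {c : W} {e : κ ↪ W}
    (hc : c ∉ Set.range e) (A B : QOp κ) :
    applyControlledOn c e (A * B) = applyControlledOn c e A * applyControlledOn c e B := by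
  ext x y
  rw [Matrix.mul_apply]
  by_cases hx : x c = true
  · rw [applyControlledOn, if_pos hx, applyOn_mul, Matrix.mul_apply]
    refine Finset.sum_congr rfl fun z _ => ?_
    simp only [applyControlledOn, if_pos hx]
    by_cases hz : x c = z c
    · rw [if_pos (hz ▸ hx)]
    · have : applyOn e A x z = 0 := if_neg fun h => hz (h c hc)
      rw [this, zero_mul, zero_mul]
  · simp only [applyControlledOn, if_neg hx]
    rw [Finset.sum_eq_single x]
    · simp [hx]
    · intro z _ hz
      rw [Matrix.one_apply_ne hz.symm, zero_mul]
    · simp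

theorem applyControlledOn_one [Fintype κ] [DecidableEq κ] (c : W) (e : κ ↪ W) :
    applyControlledOn c e (1 : QOp κ) = 1 := by
  ext x y
  simp [applyControlledOn, applyOn_one]

theorem applyControlledOn_conjTranspose {c : W} {e : κ ↪ W} (hc : c ∉ Set.range e) (A : QOp κ) :
    applyControlledOn c e A.conjTranspose = (applyControlledOn c e A).conjTranspose := by
  ext x y
  rw [Matrix.conjTranspose_apply]
  by_cases h : x c = y c
  · simp only [applyControlledOn, h, applyOn_conjTranspose, Matrix.conjTranspose_apply]
    split_ifs
    · rfl
    · by_cases hxy : x = y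
      · simp [hxy, Matrix.one_apply]
      · rw [Matrix.one_apply_ne hxy, Matrix.one_apply_ne (Ne.symm hxy), star_zero]
  · have h0 (B : QOp κ) {x y : W → Bool} (h : x c ≠ y c) : applyControlledOn c e B x y = 0 := by
      unfold applyControlledOn
      split_ifs
      · exact if_neg fun h' => h (h' c hc)
      · exact Matrix.one_apply_ne fun h' => h (congrFun h' c)
    rw [h0 _ h, h0 _ (Ne.symm h), star_zero]

theorem eval_inverse (U : QOp κ) (s : CircuitStep κ W) :
    s.inverse.eval U = (s.eval U).conjTranspose := by
  cases s with
  | gate k hk e u =>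
    simp only [inverse, eval]
    rw [← applyOn_conjTranspose]
    rfl
  | query inv e =>
    simp only [inverse, eval]
    rw [← applyOn_conjTranspose]
    cases inv <;> simp
  | controlledQuery inv c e hc =>
    simp only [inverse, eval]
    rw [← applyControlledOn_conjTranspose hc]
    cases inv <;> simp

theorem eval_mem_unitaryGroup [Fintype κ] [DecidableEq κ] {U : QOp κ}
    (hU : U ∈ Matrix.unitaryGroup (κ → Bool) ℂ) (s : CircuitStep κ W) :
    s.eval U ∈ Matrix.unitaryGroup (W → Bool) ℂ := by
  have hU' (inv : Bool) :
      (if inv then U.conjTranspose else U) ∈ Matrix.unitaryGroup (κ → Bool) ℂ := by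
    split_ifs
    · exact Unitary.star_mem hU
    · exact hU
  cases s with
  | gate k hk e u => exact applyOn_mem_unitaryGroup e u.2
  | query inv e => exact applyOn_mem_unitaryGroup e (hU' inv)
  | controlledQuery inv c e hc =>
    have h := hU' inv
    simp only [eval]
    rw [Matrix.mem_unitaryGroup_iff', Matrix.star_eq_conjTranspose] at h ⊢
    rw [← applyControlledOn_conjTranspose hc, ← applyControlledOn_mul hc, h,
      applyControlledOn_one]

end CircuitStep

namespace OracleCircuit

variable {κ W : Type}

/-- The circuit that undoes a given circuit. -/
def inverse (c : OracleCircuit κ W) : OracleCircuit κ W :=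
  (c.map CircuitStep.inverse).reverse

theorem queryCount_append (c c' : OracleCircuit κ W) :
    queryCount (c ++ c') = c.queryCount + c'.queryCount :=
  List.countP_append

theorem gateCount_append (c c' : OracleCircuit κ W) :
    gateCount (c ++ c') = c.gateCount + c'.gateCount :=
  List.countP_append

theorem queryCount_inverse (c : OracleCircuit κ W) : c.inverse.queryCount = c.queryCount := by
  simp only [queryCount, inverse, List.countP_reverse, List.countP_map]
  congr 1
  funext s
  exact s.isQuery_inverse

theorem gateCount_inverse (c : OracleCircuit κ W) : c.inverse.gateCount = c.gateCount := by
  simp only [gateCount, inverse, List.countP_reverse, List.countP_map]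
  congr 1
  funext s
  simp [s.isQuery_inverse]

variable [Fintype W] [DecidableEq W]

theorem eval_append (U : QOp κ) (c c' : OracleCircuit κ W) :
    eval U (c ++ c') = eval U c' * eval U c := by
  induction c with
  | nil => simp [eval]
  | cons s c ih => simp only [List.cons_append, eval, ih, Matrix.mul_assoc]

theorem eval_singleton (U : QOp κ) (s : CircuitStep κ W) : eval U [s] = s.eval U := by
  simp [eval]

theorem eval_inverse (U : QOp κ) (c : OracleCircuit κ W) :
    eval U c.inverse = (eval U c).conjTranspose := by
  induction c with
  | nil => simp [eval, inverse]
  | cons s c ih =>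
    have : inverse (s :: c) = inverse c ++ [s.inverse] := by simp [inverse]
    rw [this, eval_append, ih, eval_singleton, CircuitStep.eval_inverse, eval,
      Matrix.conjTranspose_mul]

theorem eval_mem_unitaryGroup [Fintype κ] [DecidableEq κ] {U : QOp κ}
    (hU : U ∈ Matrix.unitaryGroup (κ → Bool) ℂ) (c : OracleCircuit κ W) :
    eval U c ∈ Matrix.unitaryGroup (W → Bool) ℂ := by
  induction c with
  | nil => exact one_mem _
  | cons s c ih => exact mul_mem ih (s.eval_mem_unitaryGroup hU)

theorem eval_mem_unitaryGroup_of_queryCount_eq_zero (U : QOp κ) (c : OracleCircuit κ W)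
    (hc : c.queryCount = 0) : eval U c ∈ Matrix.unitaryGroup (W → Bool) ℂ := by
  induction c with
  | nil => exact one_mem _
  | cons s c ih =>
    cases s with
    | gate k hk e u => exact mul_mem (ih hc) (applyOn_mem_unitaryGroup e u.2)
    | query => simp [queryCount, CircuitStep.isQuery] at hc
    | controlledQuery => simp [queryCount, CircuitStep.isQuery] at hc

end OracleCircuit

/-! ### Multiply controlled phases with one borrowed qubit -/

/-- The matrix of the Hadamard gate. -/
noncomputable def hadamardMatrix : Matrix Bool Bool ℂ :=
  fun i j => (if i && j then -1 else 1) * (((√2)⁻¹ : ℝ) : ℂ)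

/-- The matrix of the Pauli gate `X`. -/
def pauliXMatrix : Matrix Bool Bool ℂ := fun i j => if i = j then 0 else 1

/-- The matrix of the Pauli gate `Z`. -/
def pauliZMatrix : Matrix Bool Bool ℂ := Matrix.diagonal fun i => if i then -1 else 1

theorem inv_sqrt_two_mul_self : (((√2)⁻¹ : ℝ) : ℂ) * (((√2)⁻¹ : ℝ) : ℂ) = 1 / 2 := by
  rw [← Complex.ofReal_mul, ← mul_inv, Real.mul_self_sqrt zero_le_two]
  norm_num

theorem hadamardMatrix_mul_self : hadamardMatrix * hadamardMatrix = 1 := by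
  have h := inv_sqrt_two_mul_self
  ext i j
  simp only [Matrix.mul_apply, Fintype.sum_bool, hadamardMatrix]
  cases i <;> cases j <;> simp [-Complex.ofReal_inv] <;>
    first | ring1 | linear_combination 2 * h

theorem hadamardMatrix_mul_pauliZMatrix_mul_hadamardMatrix :
    hadamardMatrix * pauliZMatrix * hadamardMatrix = pauliXMatrix := by
  have h := inv_sqrt_two_mul_self
  ext i j
  simp only [pauliZMatrix, Matrix.mul_apply, Fintype.sum_bool,
    hadamardMatrix, pauliXMatrix]
  cases i <;> cases j <;> simp [-Complex.ofReal_inv] <;>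
    first | ring1 | linear_combination 2 * h

/-- The Hadamard gate. -/
noncomputable def hadamard : Matrix.unitaryGroup Bool ℂ :=
  ⟨hadamardMatrix, by
    have : star hadamardMatrix = hadamardMatrix := by
      ext i j
      simp only [Matrix.star_apply, hadamardMatrix]
      cases i <;> cases j <;> simp [-Complex.ofReal_inv, Complex.conj_ofReal]
    rw [Matrix.mem_unitaryGroup_iff', this, hadamardMatrix_mul_self]⟩

/-- The Pauli gate `X`. -/
def pauliX : Matrix.unitaryGroup Bool ℂ :=
  ⟨pauliXMatrix, by
    rw [Matrix.mem_unitaryGroup_iff']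
    ext i j
    simp only [Matrix.mul_apply, Fintype.sum_bool, Matrix.star_apply, pauliXMatrix]
    cases i <;> cases j <;> simp⟩

/-- The Pauli gate `Z`. -/
def pauliZ : Matrix.unitaryGroup Bool ℂ :=
  ⟨pauliZMatrix, by
    rw [Matrix.mem_unitaryGroup_iff', Matrix.star_eq_conjTranspose, pauliZMatrix,
      Matrix.diagonal_conjTranspose, Matrix.diagonal_mul_diagonal, ← Matrix.diagonal_one]
    congr 1
    funext i
    cases i <;> simp⟩

section Monomial

variable {W : Type} [Fintype W] [DecidableEq W]

/-- The reversible classical map `z t ↦ z t ⊕ f z`. -/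
def toggle (t : W) (f : (W → Bool) → Bool) (z : W → Bool) : W → Bool :=
  Function.update z t (z t ^^ f z)

omit [Fintype W] in
theorem toggle_self (t : W) (f : (W → Bool) → Bool) (z : W → Bool) :
    toggle t f z t = (z t ^^ f z) := by
  simp [toggle]

omit [Fintype W] in
theorem toggle_of_ne {t w : W} (h : w ≠ t) (f : (W → Bool) → Bool) (z : W → Bool) :
    toggle t f z w = z w := by
  simp [toggle, h]

omit [Fintype W] in
theorem all_toggle {l : List W} {t : W} (h : t ∉ l) (f : (W → Bool) → Bool) (z : W → Bool) :
    l.all (toggle t f z) = l.all z := by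
  rw [Bool.eq_iff_iff, List.all_eq_true, List.all_eq_true]
  exact forall₂_congr fun w hw => by rw [toggle_of_ne (ne_of_mem_of_not_mem hw h)]

omit [Fintype W] in
theorem all_update {l : List W} {t : W} (h : t ∉ l) (z : W → Bool) (b : Bool) :
    l.all (Function.update z t b) = l.all z := by
  rw [Bool.eq_iff_iff, List.all_eq_true, List.all_eq_true]
  exact forall₂_congr fun w hw => by rw [Function.update_of_ne (ne_of_mem_of_not_mem hw h)]

theorem isMonomial_condOp (t : W) {g : (W → Bool) → Matrix Bool Bool ℂ} {f : (W → Bool) → Bool}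
    (h : ∀ x i j, g x i j ≠ 0 → j = (i ^^ f x)) : IsMonomial (condOp t g) (toggle t f) := by
  intro x y hxy
  unfold condOp at hxy
  split_ifs at hxy with h'
  · rw [eq_update_of_eqOn_ne h', h x _ _ hxy, toggle]
  · exact absurd rfl hxy

theorem phaseOp_and_eq_condOp (t : W) (f : (W → Bool) → Bool) :
    phaseOp (fun z => z t && f z) =
      condOp t fun x => if f x = true then pauliZMatrix else 1 := by
  ext x y
  rw [phaseOp, Matrix.diagonal_apply]
  by_cases hxy : x = y
  · subst hxy
    cases h : f x <;> cases h' : x t <;> simp [condOp, h, h', pauliZMatrix]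
  · rw [if_neg hxy, condOp]
    split_ifs with h1 h2
    · have : x t ≠ y t := fun h => hxy (by
        rw [eq_update_of_eqOn_ne h1, ← h, Function.update_eq_self])
      exact (Matrix.diagonal_apply_ne _ this).symm
    · have : x t ≠ y t := fun h => hxy (by
        rw [eq_update_of_eqOn_ne h1, ← h, Function.update_eq_self])
      exact (Matrix.one_apply_ne this).symm
    · rfl

end Monomial

namespace OracleCircuit

variable {κ W : Type} [DecidableEq W]

open CircuitStep

/-- A Toffoli gate up to phases, from three two-qubit gates: if the wire `a` is on, a `Z` gate on
`t` is conjugated to an `X` gate exactly if the wire `b` is on. -/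
noncomputable def toffoli (a b t : W) (ha : a ≠ t) (hb : b ≠ t) : OracleCircuit κ W :=
  [controlledGate b t hb hadamard, controlledGate a t ha pauliZ, controlledGate b t hb hadamard]

theorem isMonomial_eval_toffoli [Fintype W] (U : QOp κ) {a b t : W} (ha : a ≠ t) (hb : b ≠ t) :
    IsMonomial (eval U (toffoli a b t ha hb)) (toggle t fun z => z a && z b) := by
  have h : eval U (toffoli a b t ha hb) = condOp t fun x =>
      (if x b = true then hadamardMatrix else 1) * (if x a = true then pauliZMatrix else 1) *
      (if x b = true then hadamardMatrix else 1) := by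
    simp only [toffoli, eval, eval_controlledGate, Matrix.one_mul]
    rw [condOp_mul_condOp _ _ (fun x c => by simp [ha]),
      condOp_mul_condOp _ _ (fun x c => by simp [hb])]
    rfl
  rw [h]
  refine isMonomial_condOp t fun x i j hij => ?_
  cases hxa : x a <;> cases hxb : x b <;>
    simp only [hxa, hxb, Bool.false_eq_true, if_false, if_true, Matrix.one_mul, Matrix.mul_one,
      hadamardMatrix_mul_self, hadamardMatrix_mul_pauliZMatrix_mul_hadamardMatrix] at hij <;>
    cases i <;> cases j <;> simp [pauliXMatrix, pauliZMatrix] at hij ⊢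

/-- The Toffoli ladder. Its controls are `y₀` and the `x`s, and its rungs, the `y`s, are borrowed wires
in unknown states; the head of the lists is the last rung. The ladder toggles each rung by the
conjunction of the controls up to it, of which only the last rung is recorded here. Conjugating a
ladder with last rung `y'` by the Toffoli gate with controls `x, y'` and target `y` adds to `y` the
product of `x` and the change of `y'`. -/
theorem exists_ladder (κ : Type) [Fintype W] (y₀ : W) : ∀ (x y : W) (xs ys : List W),
    xs.length = ys.length → (y₀ :: (x :: xs ++ y :: ys)).Nodup →
    ∃ (c : OracleCircuit κ W) (σ : (W → Bool) → (W → Bool)), c.queryCount = 0 ∧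
      c.gateCount ≤ 6 * (x :: xs).length ∧ (∀ U, IsMonomial (eval U c) σ) ∧
      (∀ z w, w ∉ y :: ys → σ z w = z w) ∧
      ∀ z, σ z y = (z y ^^ (z y₀ && (x :: xs).all z)) := by
  intro x y xs
  induction xs generalizing x y with
  | nil =>
    intro ys hlen hnd
    obtain rfl : ys = [] := List.length_eq_zero_iff.1 hlen.symm
    simp at hnd
    refine ⟨toffoli x y₀ y (by tauto) (by tauto), _, rfl, by simp [gateCount, toffoli, isQuery, controlledGate],
      fun U => isMonomial_eval_toffoli U _ _, fun z w hw => ?_, fun z => ?_⟩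
    · exact toggle_of_ne (by simpa using hw) _ _
    · rw [toggle_self]
      simp [Bool.and_comm]
  | cons x' xs ih =>
    intro ys hlen hnd
    obtain _ | ⟨y', ys⟩ := ys
    · simp at hlen
    simp at hlen
    obtain ⟨c, σ, hq, hg, hσ, hfix, htog⟩ := ih x' y' ys hlen (by
      simp [List.nodup_cons, List.nodup_append] at hnd ⊢
      obtain ⟨h1, h2, h3, h4, h5, h6⟩ := hnd
      exact ⟨by tauto, by tauto, h4, by tauto, fun a ha => (h6 a ha).2⟩)
    simp [List.nodup_cons, List.nodup_append] at hnd
    have hxy : x ≠ y := by tauto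
    have hy'y : y' ≠ y := by tauto
    refine ⟨toffoli x y' y hxy hy'y ++ c ++ toffoli x y' y hxy hy'y,
      (toggle y fun z => z x && z y') ∘ σ ∘ toggle y fun z => z x && z y', ?_, ?_,
      fun U => ?_, fun z w hw => ?_, fun z => ?_⟩
    · rw [queryCount_append, queryCount_append, hq]
      rfl
    · rw [gateCount_append, gateCount_append]
      have : gateCount (toffoli (κ := κ) x y' y hxy hy'y) = 3 := rfl
      rw [this]
      simp at hg ⊢
      omega
    · rw [eval_append, eval_append, ← Matrix.mul_assoc]
      exact ((isMonomial_eval_toffoli U hxy hy'y).mul (hσ U)).mul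
        (isMonomial_eval_toffoli U hxy hy'y)
    · simp at hw
      have hwy : w ≠ y := by tauto
      simp only [Function.comp_apply]
      rw [toggle_of_ne hwy, hfix _ _ (by simp; tauto), toggle_of_ne hwy]
    · have hy : y ∉ y' :: ys := by simp; tauto
      have hx : x ∉ y' :: ys := by simp; tauto
      have hy0 : y₀ ≠ y := by tauto
      have hall : y ∉ x' :: xs := by
        obtain ⟨h1, h2, h3, h4, h5, h6⟩ := hnd
        simp only [List.mem_cons, not_or]
        exact ⟨by tauto, fun h => (h6 y h).1 rfl⟩
      simp only [Function.comp_apply]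
      rw [toggle_self, hfix _ _ hy, hfix _ _ hx, htog, toggle_self, toggle_of_ne hxy,
        toggle_of_ne hy'y, toggle_of_ne hy0, all_toggle hall, List.all_cons (a := x)]
      cases z x <;> cases z y <;> cases z y' <;> cases z y₀ <;> simp

/-- The phase flip conditioned on the wires `y₀, x₁, …, x_k, s` all being on, with `k` borrowed
wires. Two controlled phases on `s` and the last rung `y_k` of a Toffoli ladder, one of them
conjugated by the ladder, leave the change of `y_k` as the condition. -/
theorem exists_andPhase (κ : Type) [Fintype W] (s y₀ : W) (xs ys : List W)
    (hlen : xs.length ≤ ys.length) (hnd : (s :: (y₀ :: xs ++ ys)).Nodup) :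
    ∃ c : OracleCircuit κ W, c.queryCount = 0 ∧ c.gateCount ≤ 12 * (y₀ :: xs).length ∧
      ∀ U, eval U c = phaseOp fun z => z s && (y₀ :: xs).all z := by
  have hcz (U : QOp κ) (y : W) (h : y ≠ s) :
      (controlledGate y s h pauliZ).eval U = phaseOp fun z => z s && z y := by
    rw [eval_controlledGate, phaseOp_and_eq_condOp s fun z => z y]
    rfl
  obtain _ | ⟨x, xs⟩ := xs
  · have hne : y₀ ≠ s := by
      simp [List.nodup_cons] at hnd
      exact fun h => hnd.1.1 h.symm
    refine ⟨[controlledGate y₀ s hne pauliZ], rfl,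
      by simp [gateCount, isQuery, controlledGate], fun U => ?_⟩
    rw [eval_singleton, hcz]
    simp
  · obtain _ | ⟨y, ys⟩ := ys
    · simp at hlen
    simp at hlen
    have hsub : (y :: ys.take xs.length).Sublist (y :: ys) :=
      (List.take_sublist _ _).cons_cons _
    have hnd' : (s :: (y₀ :: (x :: xs ++ y :: ys.take xs.length))).Nodup :=
      hnd.sublist ((((List.Sublist.refl (x :: xs)).append hsub).cons_cons y₀).cons_cons s)
    obtain ⟨c, σ, hq, hg, hσ, hfix, htog⟩ := exists_ladder κ y₀ x y xs (ys.take xs.length)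
      (by simp [hlen]) (List.nodup_cons.1 hnd').2
    have hs : s ∉ y :: ys.take xs.length := fun h =>
      (List.nodup_cons.1 hnd').1 (List.mem_cons_of_mem _ (List.mem_append_right _ h))
    have hys : y ≠ s := fun h => hs (h ▸ List.mem_cons_self)
    refine ⟨[controlledGate y s hys pauliZ] ++ c.inverse ++ [controlledGate y s hys pauliZ] ++ c,
      ?_, ?_, fun U => ?_⟩
    · simp only [queryCount_append, queryCount_inverse, hq]
      rfl
    · have : gateCount [controlledGate (κ := κ) y s hys pauliZ] = 1 := rfl
      simp only [gateCount_append, gateCount_inverse, this]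
      simp only [List.length_cons] at hg ⊢
      omega
    · have hu : eval U c ∈ Matrix.unitaryGroup (W → Bool) ℂ :=
        eval_mem_unitaryGroup_of_queryCount_eq_zero U c hq
      simp only [eval_append, eval_singleton, hcz, eval_inverse]
      rw [← Matrix.mul_assoc, ← Matrix.mul_assoc,
        (hσ U).mul_phaseOp_mul_conjTranspose hu, phaseOp_mul_phaseOp]
      congr 1
      funext z
      rw [Function.comp_apply, htog, hfix _ _ hs, List.all_cons (a := y₀)]
      cases z s <;> cases z y <;> cases z y₀ <;> simp

/-- The phase flip conditioned on all wires of a list being on, with one borrowed wire `s`. The two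
halves `A`, `B` of the list serve as borrowed wires for each other, and the flip is the group
commutator of `X` on `s` controlled by `A` and `Z` on `s` controlled by `B`. -/
theorem exists_allPhase (κ : Type) [Fintype W] (s a b : W) (as bs : List W)
    (hab : as.length ≤ (b :: bs).length) (hba : bs.length ≤ (a :: as).length)
    (hnd : (s :: (a :: as ++ b :: bs)).Nodup) :
    ∃ c : OracleCircuit κ W, c.queryCount = 0 ∧
      c.gateCount ≤ 24 * (a :: as ++ b :: bs).length + 4 ∧
      ∀ U, eval U c = phaseOp (a :: as ++ b :: bs).all := by
  obtain ⟨c, hcq, hcg, hc⟩ := exists_andPhase κ s a as (b :: bs) hab hnd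
  obtain ⟨c', hcq', hcg', hc'⟩ := exists_andPhase κ s b bs (a :: as) hba
    (List.nodup_cons.2 ⟨fun h => (List.nodup_cons.1 hnd).1 (List.mem_append.2
      (List.mem_append.1 h).symm), (List.nodup_append_comm.1 (List.nodup_cons.1 hnd).2)⟩)
  have hsA : s ∉ a :: as := fun h => (List.nodup_cons.1 hnd).1 (List.mem_append_left _ h)
  have hsB : s ∉ b :: bs := fun h => (List.nodup_cons.1 hnd).1 (List.mem_append_right _ h)
  obtain ⟨E, hE⟩ : ∃ E : OracleCircuit κ W, E = [oneGate s hadamard] ++ c ++ [oneGate s hadamard] :=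
    ⟨_, rfl⟩
  have h1 : gateCount [oneGate (κ := κ) s hadamard] = 1 := rfl
  have h0 : queryCount [oneGate (κ := κ) s hadamard] = 0 := rfl
  have hEq : E.queryCount = 0 := by simp only [hE, queryCount_append, hcq, h0]
  have hEg : E.gateCount ≤ 12 * (a :: as).length + 2 := by
    simp only [hE, gateCount_append, h1]
    omega
  have hmon (U : QOp κ) : IsMonomial (eval U E) (toggle s (a :: as).all) := by
    have : eval U E = condOp s fun x =>
        hadamardMatrix * (if (a :: as).all x = true then pauliZMatrix else 1) * hadamardMatrix := by
      simp only [hE, eval_append, eval_singleton, eval_oneGate, hc]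
      rw [phaseOp_and_eq_condOp, condOp_mul_condOp _ _ fun _ _ => rfl,
        condOp_mul_condOp _ _ fun x d => by rw [all_update hsA]]
      simp only [Matrix.mul_assoc]
      rfl
    rw [this]
    refine isMonomial_condOp s fun x i j hij => ?_
    cases h : (a :: as).all x <;>
      simp only [h, Bool.false_eq_true, if_false, if_true, Matrix.mul_one,
        hadamardMatrix_mul_self, hadamardMatrix_mul_pauliZMatrix_mul_hadamardMatrix] at hij <;>
      cases i <;> cases j <;> simp [pauliXMatrix] at hij ⊢
  refine ⟨c' ++ E.inverse ++ c' ++ E, ?_, ?_, fun U => ?_⟩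
  · simp only [queryCount_append, queryCount_inverse, hEq, hcq']
  · simp only [gateCount_append, gateCount_inverse]
    simp only [List.length_append]
    omega
  · simp only [eval_append, eval_inverse, hc']
    rw [← Matrix.mul_assoc, ← Matrix.mul_assoc, (hmon U).mul_phaseOp_mul_conjTranspose
      (eval_mem_unitaryGroup_of_queryCount_eq_zero U E hEq), phaseOp_mul_phaseOp]
    congr 1
    funext z
    rw [Function.comp_apply, toggle_self, all_toggle hsB, List.all_append]
    cases z s <;> cases (a :: as).all z <;> cases (b :: bs).all z <;> rfl

/-- The gates `X` on the wires of a list. -/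
def flips (l : List W) : OracleCircuit κ W := l.map fun w => oneGate w pauliX

theorem isMonomial_eval_flips [Fintype W] (U : QOp κ) (l : List W) (hl : l.Nodup) :
    ∃ σ, IsMonomial (eval U (flips l)) σ ∧ (∀ z, ∀ w ∈ l, σ z w = !z w) ∧
      ∀ z, ∀ w ∉ l, σ z w = z w := by
  induction l with
  | nil =>
    refine ⟨id, fun x y hxy => ?_, by simp, by simp⟩
    by_contra h
    exact hxy (Matrix.one_apply_ne fun h' => h h'.symm)
  | cons t l ih =>
    obtain ⟨σ, hσ, hin, hout⟩ := ih (List.nodup_cons.1 hl).2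
    have ht := (List.nodup_cons.1 hl).1
    have hX : IsMonomial ((oneGate (κ := κ) t pauliX).eval U) (toggle t fun _ => true) := by
      rw [eval_oneGate]
      refine isMonomial_condOp t fun x i j hij => ?_
      change pauliXMatrix i j ≠ 0 at hij
      cases i <;> cases j <;> simp [pauliXMatrix] at hij ⊢
    refine ⟨_, hσ.mul hX, fun z w hw => ?_, fun z w hw => ?_⟩
    · rw [Function.comp_apply]
      by_cases h : w = t
      · rw [h, toggle_self, hout z t ht, Bool.xor_true]
      · rw [toggle_of_ne h, hin z w ((List.mem_cons.1 hw).resolve_left h)]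
    · rw [List.mem_cons, not_or] at hw
      rw [Function.comp_apply, toggle_of_ne hw.1, hout z w hw.2]

/-- The phase flip conditioned on all wires of a list being off takes linearly many gates, given
one further wire. -/
theorem exists_nonePhase (κ : Type) [Fintype W] (s : W) (l : List W) (hl : 2 ≤ l.length)
    (hnd : (s :: l).Nodup) :
    ∃ c : OracleCircuit κ W, c.queryCount = 0 ∧ c.gateCount ≤ 26 * l.length + 4 ∧
      ∀ U, eval U c = phaseOp fun z => l.all fun w => !z w := by
  have hsplit := List.take_append_drop ((l.length + 1) / 2) l
  obtain ⟨a, as, hA⟩ := List.exists_cons_of_length_pos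
    (l := l.take ((l.length + 1) / 2)) (by rw [List.length_take]; omega)
  obtain ⟨b, bs, hB⟩ := List.exists_cons_of_length_pos
    (l := l.drop ((l.length + 1) / 2)) (by rw [List.length_drop]; omega)
  have hlA := congrArg List.length hA
  have hlB := congrArg List.length hB
  rw [List.length_take, List.length_cons] at hlA
  rw [List.length_drop, List.length_cons] at hlB
  rw [hA, hB] at hsplit
  obtain ⟨c, hq, hg, hc⟩ := exists_allPhase κ s a b as bs (by rw [List.length_cons]; omega)
    (by rw [List.length_cons]; omega) (by rwa [hsplit])
  rw [hsplit] at hg hc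
  have hfq : queryCount (flips (κ := κ) l) = 0 := by
    simp [queryCount, flips, isQuery, oneGate]
  have hfg : gateCount (flips (κ := κ) l) = l.length := by
    simp [gateCount, flips, isQuery, oneGate, List.countP_map, Function.comp_def]
  refine ⟨inverse (flips l) ++ c ++ flips l, ?_, ?_, fun U => ?_⟩
  · simp only [queryCount_append, queryCount_inverse, hq, hfq]
  · simp only [gateCount_append, gateCount_inverse, hfg]
    omega
  · obtain ⟨σ, hσ, hin, -⟩ := isMonomial_eval_flips U l (List.nodup_cons.1 hnd).2
    simp only [eval_append, eval_inverse, hc]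
    rw [← Matrix.mul_assoc, hσ.mul_phaseOp_mul_conjTranspose
      (eval_mem_unitaryGroup_of_queryCount_eq_zero U _ hfq)]
    congr 1
    funext z
    rw [Function.comp_apply, Bool.eq_iff_iff, List.all_eq_true, List.all_eq_true]
    exact forall₂_congr fun w hw => by rw [hin z w hw]

end OracleCircuit

/-! ### Polynomials on the unit circle -/

namespace Polynomial

/-- The polynomial `z ^ d * conj (p (1 / conj z))`, for `p` of degree at most `d`. On the unit
circle it equals `z ^ d * conj (p z)`. -/
noncomputable def conjReflect (d : ℕ) (p : ℂ[X]) : ℂ[X] :=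
  (p.map (starRingEnd ℂ)).reflect d

theorem coeff_conjReflect {d k : ℕ} (hk : k ≤ d) (p : ℂ[X]) :
    (p.conjReflect d).coeff k = starRingEnd ℂ (p.coeff (d - k)) := by
  rw [conjReflect, coeff_reflect, revAt_le hk, coeff_map]

theorem eval_conjReflect {d : ℕ} {p : ℂ[X]} (hp : p.natDegree ≤ d) {z : ℂ} (hz : z ≠ 0) :
    (p.conjReflect d).eval z = z ^ d * starRingEnd ℂ (p.eval (starRingEnd ℂ z)⁻¹) := by
  let _ : Invertible z⁻¹ := invertibleOfNonzero (inv_ne_zero hz)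
  have h := eval₂_reflect_mul_pow (RingHom.id ℂ) z⁻¹ d (p.map (starRingEnd ℂ))
    ((natDegree_map_le).trans hp)
  rw [invOf_eq_inv, inv_inv] at h
  change (p.conjReflect d).eval z * _ = (p.map (starRingEnd ℂ)).eval z⁻¹ at h
  have h' : (p.map (starRingEnd ℂ)).eval z⁻¹ = starRingEnd ℂ (p.eval (starRingEnd ℂ z)⁻¹) := by
    rw [eval_map, ← eval₂_id, hom_eval₂]
    simp
  rw [← h', ← h, inv_pow]
  field_simp

theorem eval_conjReflect_of_norm_eq_one {d : ℕ} {p : ℂ[X]} (hp : p.natDegree ≤ d) {z : ℂ}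
    (hz : ‖z‖ = 1) :
    (p.conjReflect d).eval z = z ^ d * starRingEnd ℂ (p.eval z) := by
  have h0 : z ≠ 0 := by
    rintro rfl
    simp at hz
  rw [eval_conjReflect hp h0, ← Complex.inv_eq_conj hz, inv_inv]

theorem infinite_norm_eq_one : {z : ℂ | ‖z‖ = 1}.Infinite := by
  intro hfin
  refine (Set.Icc_infinite (show (-1 : ℝ) < 1 by norm_num))
    ((hfin.image Complex.re).subset fun x hx => ?_)
  refine ⟨⟨x, √(1 - x ^ 2)⟩, ?_, rfl⟩
  have : 0 ≤ 1 - x ^ 2 := by nlinarith [hx.1, hx.2]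
  rw [Set.mem_ofPred_eq, ← sq_eq_sq₀ (norm_nonneg _) zero_le_one, Complex.sq_norm,
    Complex.normSq_apply, Real.mul_self_sqrt this]
  ring

theorem eq_of_eval_eq_of_norm_eq_one {p q : ℂ[X]}
    (h : ∀ z : ℂ, ‖z‖ = 1 → p.eval z = q.eval z) : p = q :=
  eq_of_infinite_eval_eq p q (infinite_norm_eq_one.mono h)

/-- The Fejér–Riesz theorem for a trigonometric polynomial that is strictly positive on the unit
circle. The roots of `f` come in pairs `ζ`, `1 / conj ζ`, and
`(z - ζ) * (z - 1 / conj ζ)` is a multiple of `z * ‖z - ζ‖ ^ 2` on the circle, so that a pair can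
be split off. -/
theorem exists_sq_norm_eval_eq (d : ℕ) : ∀ (f : ℂ[X]) (r : ℂ → ℝ), f.natDegree ≤ 2 * d →
    (∀ z, ‖z‖ = 1 → 0 < r z) → (∀ z, ‖z‖ = 1 → f.eval z = z ^ d * r z) →
    ∃ q : ℂ[X], q.natDegree ≤ d ∧ ∀ z, ‖z‖ = 1 → ‖q.eval z‖ ^ 2 = r z := by
  induction d with
  | zero =>
    intro f r hf hr hfr
    have hf' : f = C (f.coeff 0) := eq_C_of_natDegree_le_zero (by simpa using hf)
    refine ⟨C ((√(r 1) : ℝ) : ℂ), by simp, fun z hz => ?_⟩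
    have h1 := hfr 1 (by simp)
    have hz' := hfr z hz
    rw [hf', eval_C, pow_zero, one_mul] at h1 hz'
    have : r z = r 1 := by exact_mod_cast hz'.symm.trans h1
    rw [eval_C, Complex.norm_real, Real.norm_of_nonneg (Real.sqrt_nonneg _),
      Real.sq_sqrt (hr 1 (by simp)).le, this]
  | succ d ih =>
    intro f r hf hr hfr
    have hne (z : ℂ) (hz : ‖z‖ = 1) : z ≠ 0 := fun h => by simp [h] at hz
    have hstar : f.conjReflect (2 * (d + 1)) = f := by
      refine eq_of_eval_eq_of_norm_eq_one fun z hz => ?_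
      rw [eval_conjReflect_of_norm_eq_one hf hz, hfr z hz, map_mul, map_pow, Complex.conj_ofReal,
        ← Complex.inv_eq_conj hz, two_mul, pow_add, inv_pow]
      have := hne z hz
      field_simp
    have hcoeff : f.coeff 0 = starRingEnd ℂ (f.coeff (2 * (d + 1))) := by
      conv_lhs => rw [← hstar]
      rw [coeff_conjReflect (Nat.zero_le _), Nat.sub_zero]
    by_cases h0 : f.coeff 0 = 0
    · have htop : f.coeff (2 * (d + 1)) = 0 := by
        rw [h0] at hcoeff
        simpa using hcoeff.symm
      have hdeg : f.natDegree ≤ 2 * d + 1 := by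
        by_contra hlt
        have heq : f.natDegree = 2 * (d + 1) := by omega
        rw [← heq, coeff_natDegree, leadingCoeff_eq_zero] at htop
        rw [htop, natDegree_zero] at heq
        omega
      have hX : f = X * f.divX := by
        conv_lhs => rw [← X_mul_divX_add f, h0, C_0, add_zero]
      refine (ih f.divX r ?_ hr fun z hz => ?_).imp fun q hq => ⟨hq.1.trans (Nat.le_succ d), hq.2⟩
      · rw [natDegree_divX_eq_natDegree_tsub_one]
        omega
      · have h := hfr z hz
        rw [hX, eval_mul, eval_X, pow_succ', mul_assoc] at h
        exact mul_left_cancel₀ (hne z hz) h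
    · have htop : f.coeff (2 * (d + 1)) ≠ 0 := fun h => h0 (by rw [hcoeff, h, map_zero])
      have hdeg : f.natDegree = 2 * (d + 1) := le_antisymm hf (le_natDegree_of_ne_zero htop)
      obtain ⟨ζ, hζ⟩ := Complex.exists_root (f := f)
        (natDegree_pos_iff_degree_pos.1 (by omega))
      have hζ0 : ζ ≠ 0 := by
        rintro rfl
        exact h0 (by rw [coeff_zero_eq_eval_zero]; exact hζ)
      have hζ1 : ‖ζ‖ ≠ 1 := fun h => by
        have := hfr ζ h
        rw [hζ.eq_zero] at this
        exact mul_ne_zero (pow_ne_zero _ hζ0) (Complex.ofReal_ne_zero.2 (hr ζ h).ne') this.symm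
      have hζ0' : starRingEnd ℂ ζ ≠ 0 := by simpa using hζ0
      obtain ⟨ω, hω⟩ : ∃ ω, ω = (starRingEnd ℂ ζ)⁻¹ := ⟨_, rfl⟩
      have hωf : f.eval ω = 0 := by
        rw [← hstar, eval_conjReflect hf (hω ▸ inv_ne_zero hζ0'), hω, map_inv₀,
          Complex.conj_conj, inv_inv, hζ.eq_zero, map_zero, mul_zero]
      have hωζ : ω ≠ ζ := by
        intro h
        rw [h] at hω
        apply hζ1
        have h2 : ζ * starRingEnd ℂ ζ = 1 := by
          nth_rw 1 [hω]
          exact inv_mul_cancel₀ hζ0'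
        rw [Complex.mul_conj, Complex.normSq_eq_norm_sq] at h2
        have h3 : ‖ζ‖ ^ 2 = 1 := by exact_mod_cast h2
        exact (pow_eq_one_iff_of_nonneg (norm_nonneg ζ) two_ne_zero).1 h3
      obtain ⟨g, hg⟩ := dvd_iff_isRoot.2 hζ
      have hgω : g.IsRoot ω := by
        rw [hg, eval_mul, eval_sub, eval_X, eval_C] at hωf
        exact (mul_eq_zero.1 hωf).resolve_left (sub_ne_zero.2 hωζ)
      obtain ⟨k, hk⟩ := dvd_iff_isRoot.2 hgω
      have hf0 : f ≠ 0 := fun h => h0 (by rw [h, coeff_zero])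
      have hg0 : g ≠ 0 := fun h => hf0 (by rw [hg, h, mul_zero])
      have hk0 : k ≠ 0 := fun h => hg0 (by rw [hk, h, mul_zero])
      have hkdeg : k.natDegree ≤ 2 * d := by
        rw [hg, natDegree_mul (X_sub_C_ne_zero ζ) hg0, hk,
          natDegree_mul (X_sub_C_ne_zero ω) hk0, natDegree_X_sub_C, natDegree_X_sub_C] at hdeg
        omega
      have hsub (z : ℂ) (hz : ‖z‖ = 1) : z - ζ ≠ 0 := fun h => hζ1 (by
        rw [← sub_eq_zero.1 h, hz])
      obtain ⟨q, hqdeg, hq⟩ := ih (C (-ω) * k) (fun z => r z / ‖z - ζ‖ ^ 2)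
        ((natDegree_C_mul_le _ _).trans hkdeg)
        (fun z hz => div_pos (hr z hz) (by have := hsub z hz; positivity)) (fun z hz => by
          have h := hfr z hz
          rw [hg, hk, eval_mul, eval_mul, eval_sub, eval_sub, eval_X, eval_C, eval_C] at h
          have hn : ((‖z - ζ‖ ^ 2 : ℝ) : ℂ) = (z - ζ) * (starRingEnd ℂ z - starRingEnd ℂ ζ) := by
            rw [← map_sub, Complex.mul_conj, Complex.normSq_eq_norm_sq]
          have hzz : z * starRingEnd ℂ z = 1 := by
            rw [← Complex.inv_eq_conj hz, mul_inv_cancel₀ (hne z hz)]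
          have hn0 : ((‖z - ζ‖ ^ 2 : ℝ) : ℂ) ≠ 0 := by
            have := hsub z hz
            exact Complex.ofReal_ne_zero.2 (by positivity)
          have hωζ' : ω * starRingEnd ℂ ζ = 1 := by rw [hω, inv_mul_cancel₀ hζ0']
          rw [eval_mul, eval_C, Complex.ofReal_div, mul_div_assoc', eq_div_iff hn0, hn]
          refine mul_left_cancel₀ (hne z hz) ?_
          linear_combination (z - ζ) * eval z k * (-ω * hzz + z * hωζ') + h)
      refine ⟨(X - C ζ) * q, ?_, fun z hz => ?_⟩
      · refine natDegree_mul_le.trans ?_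
        rw [natDegree_X_sub_C]
        omega
      · have := hsub z hz
        rw [eval_mul, norm_mul, mul_pow, hq z hz, eval_sub, eval_X, eval_C]
        field_simp

/-- A polynomial of norm less than one on the unit circle is an entry of a unit vector of
polynomials. -/
theorem exists_complement {d : ℕ} {p : ℂ[X]} (hp : p.natDegree ≤ d)
    (h : ∀ z, ‖z‖ = 1 → ‖p.eval z‖ < 1) :
    ∃ q : ℂ[X], q.natDegree ≤ d ∧ ∀ z, ‖z‖ = 1 → ‖p.eval z‖ ^ 2 + ‖q.eval z‖ ^ 2 = 1 := by
  have hdeg : (p.conjReflect d).natDegree ≤ d := by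
    rw [natDegree_le_iff_coeff_eq_zero]
    intro k hk
    rw [conjReflect, coeff_reflect, revAt_eq_self_of_lt hk]
    exact coeff_eq_zero_of_natDegree_lt ((natDegree_map_le.trans hp).trans_lt hk)
  obtain ⟨q, hq, hq'⟩ := exists_sq_norm_eval_eq d (X ^ d - p * p.conjReflect d)
    (fun z => 1 - ‖p.eval z‖ ^ 2) (by
      refine (natDegree_sub_le _ _).trans (max_le ?_ (natDegree_mul_le.trans (by omega)))
      rw [natDegree_X_pow]
      omega)
    (fun z hz => by nlinarith [h z hz, norm_nonneg (p.eval z)]) (fun z hz => by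
      rw [eval_sub, eval_mul, eval_pow, eval_X, eval_conjReflect_of_norm_eq_one hp hz]
      push_cast
      rw [← Complex.mul_conj']
      ring)
  exact ⟨q, hq, fun z hz => by rw [hq' z hz]; ring⟩

theorem coeff_zero_mul_conj_coeff_add_eq_zero {d : ℕ} (hd : d ≠ 0) {p q : ℂ[X]}
    (hp : p.natDegree ≤ d) (hq : q.natDegree ≤ d)
    (h : ∀ z, ‖z‖ = 1 → ‖p.eval z‖ ^ 2 + ‖q.eval z‖ ^ 2 = 1) :
    p.coeff 0 * starRingEnd ℂ (p.coeff d) + q.coeff 0 * starRingEnd ℂ (q.coeff d) = 0 := by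
  have key : p * p.conjReflect d + q * q.conjReflect d = X ^ d := by
    refine eq_of_eval_eq_of_norm_eq_one fun z hz => ?_
    have h' : (((‖p.eval z‖ ^ 2 + ‖q.eval z‖ ^ 2 : ℝ)) : ℂ) = 1 := by rw [h z hz]; simp
    push_cast at h'
    rw [← Complex.mul_conj', ← Complex.mul_conj'] at h'
    simp only [eval_add, eval_mul, eval_pow, eval_X, eval_conjReflect_of_norm_eq_one hp hz,
      eval_conjReflect_of_norm_eq_one hq hz]
    linear_combination z ^ d * h'
  have := congrArg (coeff · 0) key
  simpa [mul_coeff_zero, coeff_conjReflect, hd, coeff_X_pow, eq_comm] using this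

end Polynomial

/-! ### Quantum signal processing -/

/-- The matrix of determinant one with first column `(a, b)`. -/
def su2Matrix (a b : ℂ) : Matrix Bool Bool ℂ :=
  fun i j => if j then (if i then starRingEnd ℂ a else -starRingEnd ℂ b) else (if i then b else a)

/-- The element of `SU(2)` with first column `(a, b)`. -/
def su2 (a b : ℂ) (h : ‖a‖ ^ 2 + ‖b‖ ^ 2 = 1) : Matrix.unitaryGroup Bool ℂ :=
  ⟨su2Matrix a b, by
    have h' : a * starRingEnd ℂ a + b * starRingEnd ℂ b = 1 := by
      rw [Complex.mul_conj', Complex.mul_conj']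
      exact_mod_cast h
    rw [Matrix.mem_unitaryGroup_iff']
    ext i j
    rw [Matrix.mul_apply, Fintype.sum_bool]
    simp only [Matrix.star_apply, su2Matrix]
    cases i <;> cases j <;> simp <;> first | ring1 | linear_combination h'⟩

/-- Two orthogonal vectors of `ℂ²`, possibly zero, can be rotated onto the coordinate axes. -/
theorem exists_unitary_of_orthogonal {a b a' b' : ℂ}
    (h : a * starRingEnd ℂ a' + b * starRingEnd ℂ b' = 0) :
    ∃ G : Matrix.unitaryGroup Bool ℂ,
      (G : Matrix Bool Bool ℂ) false false * a + (G : Matrix Bool Bool ℂ) false true * b = 0 ∧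
      (G : Matrix Bool Bool ℂ) true false * a' + (G : Matrix Bool Bool ℂ) true true * b' = 0 := by
  obtain ⟨u, v, huv, h1, h2⟩ : ∃ u v : ℂ, (u ≠ 0 ∨ v ≠ 0) ∧ v * a - u * b = 0 ∧
      starRingEnd ℂ u * a' + starRingEnd ℂ v * b' = 0 := by
    by_cases hab : a = 0 ∧ b = 0
    · by_cases hab' : a' = 0 ∧ b' = 0
      · exact ⟨1, 0, by simp, by simp [hab], by simp [hab']⟩
      · refine ⟨starRingEnd ℂ b', -starRingEnd ℂ a', ?_, by simp [hab], by simp; ring⟩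
        rw [not_and_or] at hab'
        simpa [or_comm] using hab'
    · refine ⟨a, b, not_and_or.1 hab, by ring, ?_⟩
      have := congrArg (starRingEnd ℂ) h
      simpa using this
  have hpos : 0 < ‖u‖ ^ 2 + ‖v‖ ^ 2 := by
    rcases huv with h | h
    · have := norm_pos_iff.2 h
      positivity
    · have := norm_pos_iff.2 h
      positivity
  obtain ⟨c, hc⟩ : ∃ c : ℝ, c = (√(‖u‖ ^ 2 + ‖v‖ ^ 2))⁻¹ := ⟨_, rfl⟩
  have hc2 : c ^ 2 * (‖u‖ ^ 2 + ‖v‖ ^ 2) = 1 := by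
    rw [hc, inv_pow, Real.sq_sqrt hpos.le, inv_mul_cancel₀ hpos.ne']
  refine ⟨su2 (c * v) (c * starRingEnd ℂ u) ?_, ?_, ?_⟩
  · rw [norm_mul, norm_mul, Complex.norm_real, RCLike.norm_conj, mul_pow, mul_pow, Real.norm_eq_abs,
      sq_abs, ← hc2]
    ring
  · simp only [su2, su2Matrix]
    simp only [Bool.false_eq_true, if_false, if_true, map_mul, Complex.conj_conj,
      Complex.conj_ofReal]
    linear_combination (c : ℂ) * h1
  · simp only [su2, su2Matrix]
    simp only [Bool.false_eq_true, if_false, if_true, map_mul, Complex.conj_ofReal]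
    linear_combination (c : ℂ) * h2

open Polynomial in
/-- The first column of the `2 × 2` matrix of polynomials
`G_d * diag(X, 1) * G_{d-1} * ⋯ * diag(X, 1) * G₀`, for the list `[G_d, …, G_1]`. -/
noncomputable def qspColumn (G₀ : Matrix.unitaryGroup Bool ℂ) :
    List (Matrix.unitaryGroup Bool ℂ) → Bool → ℂ[X]
  | [], i => C ((G₀ : Matrix Bool Bool ℂ) i false)
  | G :: Gs, i => C ((G : Matrix Bool Bool ℂ) i false) * X * qspColumn G₀ Gs false +
      C ((G : Matrix Bool Bool ℂ) i true) * qspColumn G₀ Gs true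

open Polynomial in
/-- Every unit vector `(p, q)` of polynomials of degree at most `d` is the first column of a product
of `d + 1` rotations interleaved with `diag(X, 1)`. The lowest and the highest coefficient vectors
of `(p, q)` are orthogonal, so that one rotation makes `p` divisible by `X` and lowers the degree
of `q`. -/
theorem exists_qspColumn_eq (d : ℕ) : ∀ p q : ℂ[X], p.natDegree ≤ d → q.natDegree ≤ d →
    (∀ z, ‖z‖ = 1 → ‖p.eval z‖ ^ 2 + ‖q.eval z‖ ^ 2 = 1) →
    ∃ G₀ Gs, Gs.length = d ∧ qspColumn G₀ Gs false = p ∧ qspColumn G₀ Gs true = q := by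
  induction d with
  | zero =>
    intro p q hp hq h
    have hp' := eq_C_of_natDegree_le_zero hp
    have hq' := eq_C_of_natDegree_le_zero hq
    have h1 := h 1 (by simp)
    rw [hp', hq', eval_C, eval_C] at h1
    refine ⟨su2 _ _ h1, [], rfl, ?_, ?_⟩
    · simpa [qspColumn, su2, su2Matrix] using hp'.symm
    · simpa [qspColumn, su2, su2Matrix] using hq'.symm
  | succ d ih =>
    intro p q hp hq h
    obtain ⟨G, hG1, hG2⟩ := exists_unitary_of_orthogonal
      (coeff_zero_mul_conj_coeff_add_eq_zero d.succ_ne_zero hp hq h)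
    obtain ⟨M, hM⟩ : ∃ M : Matrix Bool Bool ℂ, M = G := ⟨_, rfl⟩
    rw [← hM] at hG1 hG2
    have hMu : M.conjTranspose * M = 1 := by
      rw [hM]
      exact Matrix.mem_unitaryGroup_iff'.1 G.2
    have hent (i j : Bool) := congrFun (congrFun hMu i) j
    simp only [Matrix.mul_apply, Fintype.sum_bool, Matrix.conjTranspose_apply] at hent
    have e00 := hent false false
    have e01 := hent false true
    have e10 := hent true false
    have e11 := hent true true
    simp at e00 e01 e10 e11
    obtain ⟨p', hp'⟩ : ∃ p', p' = C (M false false) * p + C (M false true) * q := ⟨_, rfl⟩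
    obtain ⟨q', hq'⟩ : ∃ q', q' = C (M true false) * p + C (M true true) * q := ⟨_, rfl⟩
    have hp'0 : p'.coeff 0 = 0 := by simpa [hp'] using hG1
    have hq'd : q'.coeff (d + 1) = 0 := by simpa [hq'] using hG2
    have hp'deg : p'.natDegree ≤ d + 1 := by
      rw [hp']
      exact natDegree_add_le_of_degree_le ((natDegree_C_mul_le _ _).trans hp)
        ((natDegree_C_mul_le _ _).trans hq)
    have hq'deg : q'.natDegree ≤ d + 1 := by
      rw [hq']
      exact natDegree_add_le_of_degree_le ((natDegree_C_mul_le _ _).trans hp)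
        ((natDegree_C_mul_le _ _).trans hq)
    have hq'deg' : q'.natDegree ≤ d := by
      by_contra hlt
      have heq : q'.natDegree = d + 1 := by omega
      rw [← heq, coeff_natDegree, leadingCoeff_eq_zero] at hq'd
      rw [hq'd, natDegree_zero] at heq
      omega
    have hX : X * p'.divX = p' := by
      conv_rhs => rw [← X_mul_divX_add p', hp'0, C_0, add_zero]
    obtain ⟨G₀, Gs, hlen, h1, h2⟩ := ih p'.divX q'
      (by rw [natDegree_divX_eq_natDegree_tsub_one]; omega) hq'deg' (fun z hz => by
        have e1 : ‖p'.divX.eval z‖ = ‖p'.eval z‖ := by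
          conv_rhs => rw [← hX, eval_mul, eval_X, norm_mul, hz, one_mul]
        rw [e1, ← h z hz, hp', hq']
        simp only [eval_add, eval_mul, eval_C]
        apply Complex.ofReal_injective
        push_cast
        simp only [← Complex.mul_conj', map_add, map_mul]
        linear_combination (eval z p * starRingEnd ℂ (eval z p)) * e00 +
          (starRingEnd ℂ (eval z p) * eval z q) * e01 +
          (eval z p * starRingEnd ℂ (eval z q)) * e10 +
          (eval z q * starRingEnd ℂ (eval z q)) * e11)
    have hinv (i j : Bool) :
        ((G⁻¹ : Matrix.unitaryGroup Bool ℂ) : Matrix Bool Bool ℂ) i j = starRingEnd ℂ (M j i) := by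
      rw [hM]
      rfl
    have c00 := congrArg (C : ℂ → ℂ[X]) e00
    have c01 := congrArg (C : ℂ → ℂ[X]) e01
    have c10 := congrArg (C : ℂ → ℂ[X]) e10
    have c11 := congrArg (C : ℂ → ℂ[X]) e11
    simp only [C_add, C_mul, C_1, C_0] at c00 c01 c10 c11
    refine ⟨G₀, G⁻¹ :: Gs, by simp [hlen], ?_, ?_⟩
    · simp only [qspColumn, h1, h2, hinv]
      rw [mul_assoc, hX, hp', hq']
      linear_combination p * c00 + q * c01
    · simp only [qspColumn, h1, h2, hinv]
      rw [mul_assoc, hX, hp', hq']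
      linear_combination p * c10 + q * c11

/-! ### Operators that do not touch a given wire -/

section Commutation

variable {κ W : Type} [Fintype W] [DecidableEq W]

/-- The operator `|i⟩⟨0|` on the wire `w`. -/
def ketOp (w : W) (i : Bool) : QOp W := condOp w fun _ => Matrix.single i false 1

theorem condOp_const_mul_ketOp (w : W) (G : Matrix Bool Bool ℂ) (j : Bool) :
    condOp w (fun _ => G) * ketOp w j = G false j • ketOp w false + G true j • ketOp w true := by
  rw [ketOp, condOp_mul_condOp _ _ fun _ _ => rfl]
  ext x y
  simp only [ketOp, condOp, Matrix.add_apply, Matrix.smul_apply, Matrix.mul_apply,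
    Fintype.sum_bool, Matrix.single_apply]
  by_cases h : ∀ v, v ≠ w → x v = y v
  · simp only [if_pos h]
    generalize x w = p, y w = q
    cases p <;> cases q <;> cases j <;> simp
  · simp only [if_neg h, smul_zero, add_zero]

theorem commute_ketOp_applyOn {t : W} {e : κ ↪ W} (ht : t ∉ Set.range e) (A : QOp κ) (i : Bool) :
    Commute (ketOp t i) (applyOn e A) := by
  refine commute_condOp_const t _ (fun x y h => if_neg fun h' => h (h' t ht)) fun x y b hxy => ?_
  have h1 (z : W → Bool) : Function.update z t b ∘ e = z ∘ e := by
    funext k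
    exact Function.update_of_ne (fun h => ht ⟨k, h⟩) _ _
  have h2 : (∀ w, w ∉ Set.range e → Function.update x t b w = Function.update y t b w) ↔
      ∀ w, w ∉ Set.range e → x w = y w :=
    forall₂_congr fun w _ => by
      by_cases hw : w = t
      · subst hw; simp [hxy]
      · simp [hw]
  by_cases h : ∀ w, w ∉ Set.range e → x w = y w
  · rw [applyOn, if_pos (h2.2 h), h1, h1, applyOn, if_pos h]
  · rw [applyOn, if_neg fun h' => h (h2.1 h'), applyOn, if_neg h]

theorem commute_ketOp_condOp_const {t a : W} (hta : t ≠ a) (G : Matrix Bool Bool ℂ) (i : Bool) :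
    Commute (ketOp t i) (condOp a fun _ => G) := by
  refine commute_condOp_const t _ (fun x y h => if_neg fun h' => h (h' t hta)) fun x y b hxy => ?_
  have h2 : (∀ w, w ≠ a → Function.update x t b w = Function.update y t b w) ↔
      ∀ w, w ≠ a → x w = y w :=
    forall₂_congr fun w _ => by
      by_cases hw : w = t
      · subst hw; simp [hxy]
      · simp [hw]
  simp only [condOp, h2, Function.update_of_ne hta.symm]

theorem commute_ketOp_phaseOp {t : W} {f : (W → Bool) → Bool}
    (hf : ∀ x b, f (Function.update x t b) = f x) (i : Bool) :
    Commute (ketOp t i) (phaseOp f) := by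
  refine commute_condOp_const t _ (fun x y h => Matrix.diagonal_apply_ne _ fun h' =>
    h (congrFun h' t)) fun x y b hxy => ?_
  by_cases h : x = y
  · subst h
    simp [phaseOp, hf]
  · rw [phaseOp, Matrix.diagonal_apply_ne _ h, Matrix.diagonal_apply_ne]
    intro h'
    refine h (funext fun w => ?_)
    by_cases hw : w = t
    · rw [hw, hxy]
    · have := congrFun h' w
      rwa [Function.update_of_ne hw, Function.update_of_ne hw] at this

theorem commute_ketOp_applyControlledOn {t c : W} {e : κ ↪ W} (htc : t ≠ c)
    (ht : t ∉ Set.range e) (A : QOp κ) (i : Bool) :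
    Commute (ketOp t i) (applyControlledOn c e A) := by
  have hA := commute_ketOp_applyOn ht A i
  ext x y
  have h1 := congrFun (congrFun hA x) y
  have h2 : (ketOp t i * 1) x y = (1 * ketOp t i) x y := by rw [mul_one, one_mul]
  rw [ketOp, condOp_mul_apply, mul_condOp_apply t fun _ _ => rfl] at *
  by_cases hx : x c = true
  · simpa only [applyControlledOn, Function.update_of_ne htc.symm, hx, if_true] using h1
  · simp only [applyControlledOn, Function.update_of_ne htc.symm, if_neg hx]
    exact h2

theorem applyControlledOn_mul_apply (c : W) (e : κ ↪ W) (A : QOp κ) (M : QOp W)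
    (x y : W → Bool) :
    (applyControlledOn c e A * M) x y = if x c = true then (applyOn e A * M) x y else M x y := by
  rw [Matrix.mul_apply]
  split_ifs with h
  · simp only [applyControlledOn, if_pos h, Matrix.mul_apply]
  · simp only [applyControlledOn, if_neg h]
    rw [← Matrix.mul_apply, one_mul]

theorem ketOp_mul_apply_of_ne {w : W} {i : Bool} (M : QOp W) {x : W → Bool} (h : x w ≠ i)
    (y : W → Bool) : (ketOp w i * M) x y = 0 := by
  rw [ketOp, condOp_mul_apply]
  simp [h.symm]

theorem ketOp_apply_of_ne {w : W} {i : Bool} {x : W → Bool} (h : x w ≠ i) (y : W → Bool) :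
    ketOp w i x y = 0 := by
  simpa using ketOp_mul_apply_of_ne 1 h y

theorem applyControlledOn_mul_ketOp_false {c : W} {e : κ ↪ W} (hc : c ∉ Set.range e)
    (A : QOp κ) : applyControlledOn c e A * ketOp c false = ketOp c false := by
  ext x y
  rw [applyControlledOn_mul_apply]
  split_ifs with h
  · rw [← (commute_ketOp_applyOn hc A false).eq, ketOp_mul_apply_of_ne _ (by simp [h]),
      ketOp_apply_of_ne (by simp [h])]
  · rfl

theorem applyControlledOn_mul_ketOp_true {c : W} {e : κ ↪ W} (hc : c ∉ Set.range e) (A : QOp κ) :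
    applyControlledOn c e A * ketOp c true = ketOp c true * applyOn e A := by
  ext x y
  rw [applyControlledOn_mul_apply]
  split_ifs with h
  · rw [(commute_ketOp_applyOn hc A true).eq]
  · rw [ketOp_mul_apply_of_ne _ h, ketOp_apply_of_ne h]

theorem phaseOp_mul_ketOp_true {b : W} (f : (W → Bool) → Bool) :
    phaseOp (fun z => !z b && f z) * ketOp b true = ketOp b true := by
  ext x y
  rw [phaseOp, Matrix.diagonal_mul, ketOp, condOp]
  cases x b <;> simp

theorem phaseOp_mul_ketOp_false {b : W} {f : (W → Bool) → Bool}
    (hf : ∀ x c, f (Function.update x b c) = f x) :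
    phaseOp (fun z => !z b && f z) * ketOp b false = ketOp b false * phaseOp f := by
  rw [(commute_ketOp_phaseOp hf false).eq]
  ext x y
  rw [phaseOp, phaseOp, Matrix.diagonal_mul, Matrix.diagonal_mul, ketOp, condOp]
  cases x b <;> simp

end Commutation

/-! ### Quantum signal processing circuits -/

section SignalProcessing

variable {κ W : Type}

namespace OracleCircuit

/-- The circuit that alternates the rotations `G₀, …, G_d` of the wire `b` with the circuit `c`,
for the list `[G_d, …, G_1]`. -/
def qspCircuit (b : W) (c : OracleCircuit κ W) (G₀ : Matrix.unitaryGroup Bool ℂ) :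
    List (Matrix.unitaryGroup Bool ℂ) → OracleCircuit κ W
  | [] => [CircuitStep.oneGate b G₀]
  | G :: Gs => qspCircuit b c G₀ Gs ++ c ++ [CircuitStep.oneGate b G]

theorem queryCount_qspCircuit (b : W) (c : OracleCircuit κ W) (G₀ : Matrix.unitaryGroup Bool ℂ)
    (Gs : List (Matrix.unitaryGroup Bool ℂ)) :
    (qspCircuit b c G₀ Gs).queryCount = Gs.length * c.queryCount := by
  have h (G) : queryCount [CircuitStep.oneGate (κ := κ) b G] = 0 := rfl
  induction Gs with
  | nil => simp [qspCircuit, h]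
  | cons G Gs ih =>
    simp only [qspCircuit, queryCount_append, ih, h, List.length_cons]
    ring

theorem gateCount_qspCircuit (b : W) (c : OracleCircuit κ W) (G₀ : Matrix.unitaryGroup Bool ℂ)
    (Gs : List (Matrix.unitaryGroup Bool ℂ)) :
    (qspCircuit b c G₀ Gs).gateCount = Gs.length * (c.gateCount + 1) + 1 := by
  have h (G) : gateCount [CircuitStep.oneGate (κ := κ) b G] = 1 := rfl
  induction Gs with
  | nil => simp [qspCircuit, h]
  | cons G Gs ih =>
    simp only [qspCircuit, gateCount_append, ih, h, List.length_cons]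
    ring

open Polynomial in
/-- If `c` performs `T` when the wire `b` is in state `|0⟩`, and nothing when it is in state `|1⟩`,
then signal processing takes `|0⟩ ⊗ ψ` to `|0⟩ ⊗ p(T) ψ + |1⟩ ⊗ q(T) ψ`. -/
theorem eval_qspCircuit_mul_ketOp [Fintype W] [DecidableEq W] (U : QOp κ) (b : W)
    (c : OracleCircuit κ W) (T : QOp W)
    (h0 : eval U c * ketOp b false = ketOp b false * T)
    (h1 : eval U c * ketOp b true = ketOp b true)
    (G₀ : Matrix.unitaryGroup Bool ℂ) (Gs : List (Matrix.unitaryGroup Bool ℂ)) :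
    eval U (qspCircuit b c G₀ Gs) * ketOp b false =
      ketOp b false * aeval T (qspColumn G₀ Gs false) +
      ketOp b true * aeval T (qspColumn G₀ Gs true) := by
  induction Gs with
  | nil =>
    simp only [qspCircuit, eval_singleton, CircuitStep.eval_oneGate, condOp_const_mul_ketOp,
      qspColumn, aeval_C, Algebra.algebraMap_eq_smul_one, mul_smul_comm, mul_one]
  | cons G Gs ih =>
    simp only [qspCircuit, eval_append, eval_singleton, CircuitStep.eval_oneGate]
    rw [mul_assoc, mul_assoc, ih, mul_add, ← mul_assoc (eval U c), ← mul_assoc (eval U c), h0, h1,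
      mul_add, ← mul_assoc, ← mul_assoc, ← mul_assoc, condOp_const_mul_ketOp,
      condOp_const_mul_ketOp]
    simp only [qspColumn, map_add, map_mul, aeval_C, aeval_X, Algebra.algebraMap_eq_smul_one,
      smul_mul_assoc, one_mul, add_mul, mul_add, mul_smul_comm, mul_assoc]
    abel

end OracleCircuit

end SignalProcessing

/-! ### Qubitization -/

section Qubitization

/-- The isometry `|0^m⟩ ⊗ I`. -/
def zeroIsometry (m n : ℕ) : Matrix (Wires m n → Bool) (Fin n → Bool) ℂ :=
  fun z y => if z = Sum.elim (fun _ => false) y then 1 else 0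

variable {m n : ℕ}

theorem mul_zeroIsometry_apply (M : QOp (Wires m n)) (x : Wires m n → Bool) (y : Fin n → Bool) :
    (M * zeroIsometry m n) x y = M x (Sum.elim (fun _ => false) y) := by
  simp [Matrix.mul_apply, zeroIsometry]

theorem conjTranspose_zeroIsometry_mul_apply {ι : Type} (M : Matrix (Wires m n → Bool) ι ℂ)
    (x : Fin n → Bool) (y : ι) :
    ((zeroIsometry m n).conjTranspose * M) x y = M (Sum.elim (fun _ => false) x) y := by
  simp [Matrix.mul_apply, zeroIsometry, Matrix.conjTranspose_apply]

theorem zeroBlock_eq (M : QOp (Wires m n)) :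
    zeroBlock M = (zeroIsometry m n).conjTranspose * M * zeroIsometry m n := by
  rw [Matrix.mul_assoc]
  ext x y
  rw [conjTranspose_zeroIsometry_mul_apply, mul_zeroIsometry_apply]
  rfl

theorem conjTranspose_zeroIsometry_mul_self :
    (zeroIsometry m n).conjTranspose * zeroIsometry m n = 1 := by
  ext x y
  rw [conjTranspose_zeroIsometry_mul_apply, zeroIsometry, Matrix.one_apply]
  congr 1
  exact propext ⟨fun h => funext fun i => congrFun h (Sum.inr i), fun h => by rw [h]⟩

/-- Whether all ancilla wires are in state `|0⟩`. -/
def ancillasZero (z : Wires m n → Bool) : Bool :=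
  (List.ofFn (n := m) (Sum.inl : Fin m → Wires m n)).all fun w => !z w

theorem ancillasZero_eq_true_iff (z : Wires m n → Bool) :
    ancillasZero z = true ↔ ∀ i, z (Sum.inl i) = false := by
  simp [ancillasZero]

theorem two_smul_zeroIsometry_mul_conjTranspose_self :
    (2 : ℂ) • (zeroIsometry m n * (zeroIsometry m n).conjTranspose) = 1 - phaseOp ancillasZero := by
  ext x y
  rw [Matrix.smul_apply, Matrix.mul_apply, Matrix.sub_apply, phaseOp]
  rw [Finset.sum_eq_single (x ∘ Sum.inr)]
  · have hx : x = Sum.elim (fun _ => false) (x ∘ Sum.inr) ↔ ancillasZero x = true := by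
      rw [ancillasZero_eq_true_iff]
      refine ⟨fun h i => by rw [h, Sum.elim_inl], fun h => funext fun w => ?_⟩
      cases w with
      | inl i => rw [h, Sum.elim_inl]
      | inr j => rfl
    simp only [Matrix.conjTranspose_apply, zeroIsometry, hx]
    by_cases h : ancillasZero x = true
    · rw [← hx.2 h]
      by_cases hxy : x = y
      · subst hxy
        simp [h]
        norm_num
      · rw [Matrix.one_apply_ne hxy, Matrix.diagonal_apply_ne _ hxy]
        simp [Ne.symm hxy]
    · by_cases hxy : x = y
      · subst hxy
        simp [h]
      · rw [Matrix.one_apply_ne hxy, Matrix.diagonal_apply_ne _ hxy]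
        simp [h]
  · intro u _ hu
    have : x ≠ Sum.elim (fun _ => false) u := fun h => hu (by
      rw [h]
      rfl)
    rw [zeroIsometry, if_neg this, zero_mul]
  · simp

theorem ketOp_false_mul_zeroIsometry (i : Fin m) :
    (ketOp (Sum.inl i) false : QOp (Wires m n)) * zeroIsometry m n = zeroIsometry m n := by
  ext x y
  rw [mul_zeroIsometry_apply, zeroIsometry, ketOp, condOp, Sum.elim_inl, Matrix.single_apply]
  by_cases h : x = Sum.elim (fun _ => false) y
  · subst h
    simp
  · rw [if_neg h]
    split_ifs with h1 h2
    · refine absurd (funext fun w => ?_) h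
      by_cases hw : w = Sum.inl i
      · rw [hw, ← h2.1, Sum.elim_inl]
      · exact h1 w hw
    · rfl
    · rfl

theorem zeroBlock_eq_mul_ketOp (i : Fin m) (M : QOp (Wires m n)) :
    zeroBlock M = (zeroIsometry m n).conjTranspose * (M * ketOp (Sum.inl i) false) *
      zeroIsometry m n := by
  rw [Matrix.mul_assoc, Matrix.mul_assoc M, ketOp_false_mul_zeroIsometry, zeroBlock_eq,
    Matrix.mul_assoc]

theorem conjTranspose_zeroIsometry_mul_ketOp_true (i : Fin m) :
    (zeroIsometry m n).conjTranspose * (ketOp (Sum.inl i) true : QOp (Wires m n)) = 0 := by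
  ext x y
  rw [conjTranspose_zeroIsometry_mul_apply, ketOp_apply_of_ne (by simp), Matrix.zero_apply]

theorem conjTranspose_zeroIsometry_mul_ketOp_false (i : Fin m) :
    (zeroIsometry m n).conjTranspose * (ketOp (Sum.inl i) false : QOp (Wires m n)) =
      (zeroIsometry m n).conjTranspose := by
  have h : (ketOp (Sum.inl i) false : QOp (Wires m n)).conjTranspose = ketOp (Sum.inl i) false := by
    rw [ketOp, condOp_conjTranspose _ fun _ _ => rfl]
    simp [Matrix.conjTranspose_single]
  have h' := congrArg Matrix.conjTranspose (ketOp_false_mul_zeroIsometry (n := n) i)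
  rwa [Matrix.conjTranspose_mul, h] at h'

open Polynomial in
/-- The qubitization identity: if `T` is unitary and `T + T⁻¹` maps the range of the isometry `J` to
itself as `2 g`, then the compressions of the powers of `T` are Chebyshev polynomials of `g`. On an
eigenvector of `g` for the eigenvalue `(w + w⁻¹) / 2`, the compression of `p(T)` is therefore
the mean of `p w` and `p w⁻¹`. -/
theorem compression_aeval_mulVec {ι κ : Type} [Fintype ι] [DecidableEq ι] [Fintype κ]
    [DecidableEq κ] {T : Matrix ι ι ℂ} {J : Matrix ι κ ℂ} {g : Matrix κ κ ℂ}
    (hT : T * T.conjTranspose = 1) (hJ : J.conjTranspose * J = 1)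
    (hg : J.conjTranspose * T * J = g)
    (hTJ : T * J + T.conjTranspose * J = J * ((2 : ℂ) • g)) {w : ℂ} (hw : w ≠ 0) {v : κ → ℂ}
    (hv : g.mulVec v = ((w + w⁻¹) / 2) • v) (p : ℂ[X]) :
    (J.conjTranspose * aeval T p * J).mulVec v = ((p.eval w + p.eval w⁻¹) / 2) • v := by
  have hpow (k : ℕ) : (J.conjTranspose * T ^ k * J).mulVec v = ((w ^ k + w⁻¹ ^ k) / 2) • v := by
    induction k using Nat.twoStepInduction with
    | zero => simp [hJ]
    | one => rw [pow_one, pow_one, pow_one, hg, hv]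
    | more k ih ih' =>
      have h : J.conjTranspose * T ^ (k + 2) * J =
          J.conjTranspose * T ^ (k + 1) * J * ((2 : ℂ) • g) - J.conjTranspose * T ^ k * J := by
        rw [Matrix.mul_assoc _ J, ← hTJ, Matrix.mul_add, ← Matrix.mul_assoc, ← Matrix.mul_assoc,
          Matrix.mul_assoc _ _ T, ← pow_succ, Matrix.mul_assoc _ _ T.conjTranspose, pow_succ T k,
          Matrix.mul_assoc (T ^ k), hT, Matrix.mul_one]
        abel
      rw [h, Matrix.sub_mulVec, ← Matrix.mulVec_mulVec, Matrix.smul_mulVec, hv, smul_smul,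
        Matrix.mulVec_smul, ih, ih', smul_smul, ← sub_smul]
      congr 1
      have hww : w * w⁻¹ = 1 := mul_inv_cancel₀ hw
      generalize w⁻¹ = w' at hww
      linear_combination ((w ^ k + w' ^ k) / 2) * hww
  induction p using Polynomial.induction_on' with
  | add p q hp hq =>
    rw [map_add, Matrix.mul_add, Matrix.add_mul, Matrix.add_mulVec, hp, hq, ← add_smul, eval_add,
      eval_add]
    congr 1
    ring
  | monomial k a =>
    rw [aeval_monomial, Algebra.algebraMap_eq_smul_one, smul_mul_assoc, one_mul, Matrix.mul_smul,
      Matrix.smul_mul, Matrix.smul_mulVec, hpow, smul_smul, eval_monomial, eval_monomial]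
    congr 1
    ring

end Qubitization

/-! ### The block-encoded eigenvalue transformation -/

section EigenvalueTransformation

variable {m n : ℕ}

/-- The placement of the oracle register behind two further ancilla wires. -/
def oracleEmbedding (m n : ℕ) : Wires m n ↪ Wires (m + 2) n :=
  ⟨Sum.map (fun i => i.succ.succ) id,
    Sum.map_injective.2 ⟨(Fin.succ_injective _).comp (Fin.succ_injective _), Function.injective_id⟩⟩

theorem inl_zero_notMem_range_oracleEmbedding :
    (Sum.inl 0 : Wires (m + 2) n) ∉ Set.range (oracleEmbedding m n) := by
  rintro ⟨i | j, h⟩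
  · exact Fin.succ_ne_zero _ (Sum.inl_injective h)
  · cases h

theorem inl_one_notMem_range_oracleEmbedding :
    (Sum.inl 1 : Wires (m + 2) n) ∉ Set.range (oracleEmbedding m n) := by
  rintro ⟨i | j, h⟩
  · exact Fin.succ_ne_zero _ (Fin.succ_injective _ (Sum.inl_injective h))
  · cases h

theorem zeroBlock_applyOn_oracleEmbedding (U : QOp (Wires m n)) :
    zeroBlock (applyOn (oracleEmbedding m n) U) = zeroBlock U := by
  ext x y
  have h : ∀ w, w ∉ Set.range (oracleEmbedding m n) →
      Sum.elim (fun _ => false) x w = Sum.elim (fun _ => false) y w := by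
    rintro (i | j) hw
    · rfl
    · exact absurd ⟨Sum.inr j, rfl⟩ hw
  have h' (z : Fin n → Bool) :
      Sum.elim (fun _ => false) z ∘ oracleEmbedding m n = Sum.elim (fun _ => false) z := by
    funext w
    cases w <;> rfl
  rw [zeroBlock, applyOn, if_pos h, h', h']
  rfl

/-- A linear combination of the oracle and the identity, from one ancilla qubit that is rotated
before and after it controls the oracle. -/
def lcuCircuit (m n : ℕ) (G G' : Matrix.unitaryGroup Bool ℂ) :
    OracleCircuit (Wires m n) (Wires (m + 2) n) :=
  [CircuitStep.oneGate (Sum.inl 1) G,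
    CircuitStep.controlledQuery false (Sum.inl 1) (oracleEmbedding m n)
      inl_one_notMem_range_oracleEmbedding,
    CircuitStep.oneGate (Sum.inl 1) G']

theorem commute_ketOp_eval_lcuCircuit (U : QOp (Wires m n)) (G G' : Matrix.unitaryGroup Bool ℂ)
    (i : Bool) :
    Commute (ketOp (Sum.inl 0) i) (OracleCircuit.eval U (lcuCircuit m n G G')) := by
  have h01 : (Sum.inl 0 : Wires (m + 2) n) ≠ Sum.inl 1 := fun h =>
    Fin.zero_ne_one (Sum.inl_injective h)
  simp only [lcuCircuit, OracleCircuit.eval, CircuitStep.eval_oneGate, one_mul]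
  exact ((commute_ketOp_condOp_const h01 _ i).mul_right
    (commute_ketOp_applyControlledOn h01 inl_zero_notMem_range_oracleEmbedding _ i)).mul_right
      (commute_ketOp_condOp_const h01 _ i)

theorem zeroBlock_eval_lcuCircuit (U : QOp (Wires m n)) (G G' : Matrix.unitaryGroup Bool ℂ) :
    zeroBlock (OracleCircuit.eval U (lcuCircuit m n G G')) =
      ((G' : Matrix Bool Bool ℂ) false false * (G : Matrix Bool Bool ℂ) false false) • 1 +
      ((G' : Matrix Bool Bool ℂ) false true * (G : Matrix Bool Bool ℂ) true false) •
        zeroBlock U := by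
  have ha := inl_one_notMem_range_oracleEmbedding (m := m) (n := n)
  have key : OracleCircuit.eval U (lcuCircuit m n G G') * ketOp (Sum.inl 1) false =
      (((G' : Matrix Bool Bool ℂ) false false * (G : Matrix Bool Bool ℂ) false false) •
          ketOp (Sum.inl 1) false +
        ((G' : Matrix Bool Bool ℂ) true false * (G : Matrix Bool Bool ℂ) false false) •
          ketOp (Sum.inl 1) true) +
      (((G' : Matrix Bool Bool ℂ) false true * (G : Matrix Bool Bool ℂ) true false) •
          ketOp (Sum.inl 1) false +
        ((G' : Matrix Bool Bool ℂ) true true * (G : Matrix Bool Bool ℂ) true false) •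
          ketOp (Sum.inl 1) true) * applyOn (oracleEmbedding m n) U := by
    simp only [lcuCircuit, OracleCircuit.eval, CircuitStep.eval_oneGate, one_mul]
    rw [mul_assoc, condOp_const_mul_ketOp, mul_add, mul_smul_comm, mul_smul_comm, mul_assoc,
      mul_assoc]
    simp only [CircuitStep.eval, Bool.false_eq_true, if_false]
    rw [applyControlledOn_mul_ketOp_false ha, applyControlledOn_mul_ketOp_true ha, ← mul_assoc,
      condOp_const_mul_ketOp, condOp_const_mul_ketOp]
    simp only [add_mul, smul_add, smul_smul, smul_mul_assoc]
    simp only [mul_comm]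
  have hf := conjTranspose_zeroIsometry_mul_ketOp_false (m := m + 2) (n := n) 1
  have ht := conjTranspose_zeroIsometry_mul_ketOp_true (m := m + 2) (n := n) 1
  rw [zeroBlock_eq_mul_ketOp 1, key, Matrix.mul_add, Matrix.mul_add, ← Matrix.mul_assoc,
    Matrix.mul_add]
  simp only [Matrix.mul_smul, hf, ht, smul_zero, add_zero, Matrix.smul_mul, Matrix.add_mul]
  rw [conjTranspose_zeroIsometry_mul_self, ← zeroBlock_eq, zeroBlock_applyOn_oracleEmbedding]

/-- The walk operator `Z * V⁻¹ * Z * V` of two reflections, for circuits `v` performing `V` and `z`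
performing `Z`. -/
def walkCircuit {κ W : Type} (v z : OracleCircuit κ W) : OracleCircuit κ W :=
  v ++ z ++ v.inverse ++ z

/-- Whether all ancilla wires but the first are in state `|0⟩`. -/
def otherAncillasZero (z : Wires (m + 1) n → Bool) : Bool :=
  (List.ofFn fun i : Fin m => (Sum.inl i.succ : Wires (m + 1) n)).all fun w => !z w

theorem ancillasZero_succ :
    (ancillasZero : (Wires (m + 1) n → Bool) → Bool) =
      fun z => !z (Sum.inl 0) && otherAncillasZero z := by
  funext z
  rw [ancillasZero, List.ofFn_succ, List.all_cons]
  rfl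

theorem otherAncillasZero_update (z : Wires (m + 1) n → Bool) (b : Bool) :
    otherAncillasZero (Function.update z (Sum.inl 0) b) = otherAncillasZero z := by
  rw [Bool.eq_iff_iff]
  simp [otherAncillasZero]

theorem phaseOp_conjTranspose {W : Type} [Fintype W] [DecidableEq W] (f : (W → Bool) → Bool) :
    (phaseOp f).conjTranspose = phaseOp f := by
  rw [phaseOp, Matrix.diagonal_conjTranspose]
  congr 1
  funext x
  cases h : f x <;> simp [h]

theorem phaseOp_mul_self {W : Type} [Fintype W] [DecidableEq W] (f : (W → Bool) → Bool) :
    phaseOp f * phaseOp f = 1 := by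
  rw [phaseOp_mul_phaseOp]
  simp [phaseOp]

theorem commute_ketOp_otherAncillasZero (i : Bool) :
    Commute (ketOp (Sum.inl 0) i)
      (phaseOp otherAncillasZero : QOp (Wires (m + 1) n)) :=
  commute_ketOp_phaseOp (fun z b => otherAncillasZero_update z b) i

theorem phaseOp_ancillasZero_mul_ketOp_false :
    phaseOp ancillasZero * ketOp (Sum.inl 0) false =
      ketOp (Sum.inl 0) false * (phaseOp otherAncillasZero : QOp (Wires (m + 1) n)) := by
  rw [ancillasZero_succ, phaseOp_mul_ketOp_false fun z b => otherAncillasZero_update z b]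

theorem phaseOp_ancillasZero_mul_ketOp_true :
    phaseOp ancillasZero * ketOp (Sum.inl 0) true =
      (ketOp (Sum.inl 0) true : QOp (Wires (m + 1) n)) := by
  rw [ancillasZero_succ, phaseOp_mul_ketOp_true]

theorem Commute.conjTranspose_of_mem_unitaryGroup {ι : Type} [Fintype ι] [DecidableEq ι]
    {K V : Matrix ι ι ℂ} (h : Commute K V) (hV : V ∈ Matrix.unitaryGroup ι ℂ) :
    Commute K V.conjTranspose := by
  have hVV : V.conjTranspose * V = 1 := Matrix.mem_unitaryGroup_iff'.1 hV
  have hVV' : V * V.conjTranspose = 1 := Matrix.mem_unitaryGroup_iff.1 hV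
  have h' : V.conjTranspose * (V * K) * V.conjTranspose =
      V.conjTranspose * (K * V) * V.conjTranspose := by rw [h.eq]
  rw [← mul_assoc, hVV, one_mul, mul_assoc, mul_assoc, hVV', mul_one] at h'
  exact h'

section Walk

variable {κ : Type} {U : QOp κ} {v z : OracleCircuit κ (Wires (m + 1) n)}

theorem eval_walkCircuit {W : Type} [Fintype W] [DecidableEq W] (U : QOp κ)
    (v z : OracleCircuit κ W) :
    OracleCircuit.eval U (walkCircuit v z) = OracleCircuit.eval U z *
      (OracleCircuit.eval U v).conjTranspose * OracleCircuit.eval U z *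
      OracleCircuit.eval U v := by
  simp only [walkCircuit, OracleCircuit.eval_append, OracleCircuit.eval_inverse, Matrix.mul_assoc]

/-- In the walk circuit only the reflections depend on the signal qubit; if they are switched off,
`V⁻¹ * V = 1` remains. -/
theorem eval_walkCircuit_mul_ketOp_true
    (hz : OracleCircuit.eval U z = phaseOp ancillasZero)
    (hv : OracleCircuit.eval U v ∈ Matrix.unitaryGroup (Wires (m + 1) n → Bool) ℂ)
    (hvk : ∀ i, Commute (ketOp (Sum.inl 0) i) (OracleCircuit.eval U v)) :
    OracleCircuit.eval U (walkCircuit v z) * ketOp (Sum.inl 0) true =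
      ketOp (Sum.inl 0) true := by
  rw [eval_walkCircuit, hz]
  have hVV : (OracleCircuit.eval U v).conjTranspose * OracleCircuit.eval U v = 1 :=
    Matrix.mem_unitaryGroup_iff'.1 hv
  rw [mul_assoc, ← (hvk true).eq, mul_assoc, ← mul_assoc (phaseOp ancillasZero),
    phaseOp_ancillasZero_mul_ketOp_true, mul_assoc,
    ← mul_assoc (OracleCircuit.eval U v).conjTranspose,
    ← ((hvk true).conjTranspose_of_mem_unitaryGroup hv).eq, mul_assoc, ← mul_assoc,
    phaseOp_ancillasZero_mul_ketOp_true, hVV, mul_one]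

theorem eval_walkCircuit_mul_ketOp_false
    (hz : OracleCircuit.eval U z = phaseOp ancillasZero)
    (hv : OracleCircuit.eval U v ∈ Matrix.unitaryGroup (Wires (m + 1) n → Bool) ℂ)
    (hvk : ∀ i, Commute (ketOp (Sum.inl 0) i) (OracleCircuit.eval U v)) :
    OracleCircuit.eval U (walkCircuit v z) * ketOp (Sum.inl 0) false =
      ketOp (Sum.inl 0) false * (phaseOp otherAncillasZero *
        ((OracleCircuit.eval U v).conjTranspose * phaseOp otherAncillasZero *
          OracleCircuit.eval U v)) := by
  have hv0 := (hvk false).eq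
  have hV0 := ((hvk false).conjTranspose_of_mem_unitaryGroup hv).eq
  have hz0 := phaseOp_ancillasZero_mul_ketOp_false (m := m) (n := n)
  rw [eval_walkCircuit, hz]
  generalize OracleCircuit.eval U v = V at *
  generalize (phaseOp otherAncillasZero : QOp (Wires (m + 1) n)) = Z at *
  generalize (ketOp (Sum.inl 0) false : QOp (Wires (m + 1) n)) = K at *
  generalize (phaseOp ancillasZero : QOp (Wires (m + 1) n)) = R at *
  calc R * V.conjTranspose * R * V * K
      = R * V.conjTranspose * (R * K) * V := by simp only [mul_assoc, ← hv0]
    _ = R * (V.conjTranspose * K) * Z * V := by simp only [hz0, mul_assoc]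
    _ = R * K * V.conjTranspose * Z * V := by simp only [← hV0, mul_assoc]
    _ = K * (Z * (V.conjTranspose * Z * V)) := by simp only [hz0, mul_assoc]

end Walk

/-- On operators commuting with the signal qubit, `1 - Z` agrees with twice the projection onto the
states with all ancillas zero. -/
theorem one_sub_phaseOp_mul_zeroIsometry {M : QOp (Wires (m + 1) n)}
    (hM : Commute (ketOp (Sum.inl 0) false) M) :
    (1 - phaseOp otherAncillasZero) * M * zeroIsometry (m + 1) n =
      (2 : ℂ) • (zeroIsometry (m + 1) n * zeroBlock M) := by
  have hc := ((Commute.one_right _).sub_right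
    (commute_ketOp_otherAncillasZero (m := m) (n := n) false)).mul_right hM
  have h2 : (1 - phaseOp ancillasZero) * ketOp (Sum.inl 0) false =
      ketOp (Sum.inl 0) false * (1 - (phaseOp otherAncillasZero : QOp (Wires (m + 1) n))) := by
    rw [sub_mul, phaseOp_ancillasZero_mul_ketOp_false, one_mul, mul_sub, mul_one]
  have hK := ketOp_false_mul_zeroIsometry (m := m + 1) (n := n) 0
  have h1 : (1 - phaseOp otherAncillasZero) * M * zeroIsometry (m + 1) n =
      (1 - phaseOp ancillasZero) * M * zeroIsometry (m + 1) n := by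
    rw [← hK, ← Matrix.mul_assoc, ← Matrix.mul_assoc, ← hc.eq, mul_assoc, ← hM.eq, ← mul_assoc,
      ← mul_assoc, h2]
  rw [h1, ← two_smul_zeroIsometry_mul_conjTranspose_self, Matrix.smul_mul, Matrix.smul_mul,
    zeroBlock_eq]
  simp only [Matrix.mul_assoc]

/-- The relations between the isometry `|0⟩ ⊗ I` and the walk operator `T = Z * V⁻¹ * Z * V` of a
block-encoding `V` of the Hermitian operator `h`: the compression of `T` is `2 h² - 1`, and
`T + T⁻¹` preserves the range of the isometry. -/
theorem walk_relations {V T : QOp (Wires (m + 1) n)}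
    (hv : V ∈ Matrix.unitaryGroup (Wires (m + 1) n → Bool) ℂ)
    (hvk : Commute (ketOp (Sum.inl 0) false) V) (hh : (zeroBlock V).IsHermitian)
    (hT : T = phaseOp otherAncillasZero *
      (V.conjTranspose * phaseOp otherAncillasZero * V)) :
    T * T.conjTranspose = 1 ∧
    (zeroIsometry (m + 1) n).conjTranspose * T * zeroIsometry (m + 1) n =
      (2 : ℂ) • (zeroBlock V * zeroBlock V) - 1 ∧
    T * zeroIsometry (m + 1) n + T.conjTranspose * zeroIsometry (m + 1) n =
      zeroIsometry (m + 1) n * ((2 : ℂ) • ((2 : ℂ) • (zeroBlock V * zeroBlock V) - 1)) := by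
  have hVV : V.conjTranspose * V = 1 := Matrix.mem_unitaryGroup_iff'.1 hv
  have hVV' : V * V.conjTranspose = 1 := Matrix.mem_unitaryGroup_iff.1 hv
  have hZJ (M : QOp (Wires (m + 1) n)) := one_sub_phaseOp_mul_zeroIsometry (M := M)
  have hZk := commute_ketOp_otherAncillasZero (m := m) (n := n) false
  have hVk := hvk.conjTranspose_of_mem_unitaryGroup hv
  have hZZ := phaseOp_mul_self (otherAncillasZero (m := m) (n := n))
  have hZH := phaseOp_conjTranspose (otherAncillasZero (m := m) (n := n))
  have hJJ := conjTranspose_zeroIsometry_mul_self (m := m + 1) (n := n)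
  have hblock (M : QOp (Wires (m + 1) n)) := zeroBlock_eq M
  generalize (phaseOp otherAncillasZero : QOp (Wires (m + 1) n)) = Z at *
  generalize (ketOp (Sum.inl 0) false : QOp (Wires (m + 1) n)) = K at *
  generalize zeroIsometry (m + 1) n = J at *
  obtain ⟨S, hS⟩ : ∃ S, S = V.conjTranspose * Z * V := ⟨_, rfl⟩
  rw [← hS] at hT
  have hSH : S.conjTranspose = S := by
    rw [hS, Matrix.conjTranspose_mul, Matrix.conjTranspose_mul, hZH,
      Matrix.conjTranspose_conjTranspose, Matrix.mul_assoc]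
  have hSS : S * S = 1 := by
    have : S * S = V.conjTranspose * (Z * (V * V.conjTranspose) * Z) * V := by
      simp only [hS, mul_assoc]
    rw [this, hVV', mul_one, hZZ, mul_one, hVV]
  have hSk : Commute K S := by
    rw [hS]
    exact (hVk.mul_right hZk).mul_right hvk
  have hblock' : J.conjTranspose * V.conjTranspose * J = zeroBlock V := by
    rw [← hh.eq, hblock, Matrix.conjTranspose_mul, Matrix.conjTranspose_mul,
      Matrix.conjTranspose_conjTranspose, Matrix.mul_assoc]
  have hSJ : zeroBlock S = 1 - (2 : ℂ) • (zeroBlock V * zeroBlock V) := by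
    have h1 : S = 1 - V.conjTranspose * ((1 - Z) * V) := by
      rw [hS, sub_mul, mul_sub, one_mul, hVV, mul_assoc]
      abel
    have h2 := hZJ V hvk
    rw [hblock S, h1, Matrix.mul_sub, Matrix.sub_mul, Matrix.mul_one, hJJ, Matrix.mul_assoc _ _ J,
      Matrix.mul_assoc _ _ J, h2, Matrix.mul_smul, Matrix.mul_smul, ← Matrix.mul_assoc _ J,
      ← Matrix.mul_assoc _ _ (zeroBlock V), ← Matrix.mul_assoc, hblock']
  have hZJ1 : Z * J = -J := by
    have h := hZJ 1 (Commute.one_right _)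
    rw [mul_one, hblock, Matrix.mul_one, hJJ, Matrix.mul_one, Matrix.sub_mul, Matrix.one_mul,
      two_smul] at h
    have h2 : Z * J = J - (J - Z * J) := by abel
    rw [h2, h]
    abel
  have hJZ : J.conjTranspose * Z = -J.conjTranspose := by
    rw [← Matrix.conjTranspose_neg, ← hZJ1, Matrix.conjTranspose_mul, hZH]
  refine ⟨?_, ?_, ?_⟩
  · rw [hT, Matrix.conjTranspose_mul, hSH, hZH, mul_assoc, ← mul_assoc S, hSS, one_mul, hZZ]
  · rw [hT, ← Matrix.mul_assoc, hJZ, Matrix.neg_mul, Matrix.neg_mul, ← hblock, hSJ, neg_sub]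
  · have h := hZJ S hSk
    rw [hT, Matrix.conjTranspose_mul, hSH, hZH, Matrix.mul_assoc S, hZJ1, Matrix.mul_neg,
      ← neg_sub, ← hSJ, smul_neg, Matrix.mul_neg, Matrix.mul_smul, ← h, sub_mul, one_mul,
      Matrix.sub_mul]
    abel

open Polynomial in
/-- Signal processing with the walk operator of a block-encoding of the Hermitian operator `h`: an
eigenvector of `h` for the eigenvalue `x` is multiplied by the mean of `p w` and `p w⁻¹`, where
`(w + w⁻¹) / 2 = 2 x² - 1`. -/
theorem zeroBlock_eval_qspCircuit_mulVec {κ : Type} (U : QOp κ)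
    {v z : OracleCircuit κ (Wires (m + 1) n)}
    (hz : OracleCircuit.eval U z = phaseOp ancillasZero)
    (hv : OracleCircuit.eval U v ∈ Matrix.unitaryGroup (Wires (m + 1) n → Bool) ℂ)
    (hvk : ∀ i, Commute (ketOp (Sum.inl 0) i) (OracleCircuit.eval U v))
    (hh : (zeroBlock (OracleCircuit.eval U v)).IsHermitian) {x : ℝ} {w : ℂ} (hw : w ≠ 0)
    (hwx : (w + w⁻¹) / 2 = 2 * (x : ℂ) ^ 2 - 1) {u : (Fin n → Bool) → ℂ}
    (hu : (zeroBlock (OracleCircuit.eval U v)).mulVec u = (x : ℂ) • u)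
    (G₀ : Matrix.unitaryGroup Bool ℂ) (Gs : List (Matrix.unitaryGroup Bool ℂ)) :
    (zeroBlock (OracleCircuit.eval U
      (OracleCircuit.qspCircuit (Sum.inl 0) (walkCircuit v z) G₀ Gs))).mulVec u =
      (((qspColumn G₀ Gs false).eval w + (qspColumn G₀ Gs false).eval w⁻¹) / 2) • u := by
  obtain ⟨hT1, hT2, hT3⟩ := walk_relations hv (hvk false) hh rfl
  have hgu : ((2 : ℂ) • (zeroBlock (OracleCircuit.eval U v) *
      zeroBlock (OracleCircuit.eval U v)) - 1).mulVec u = ((w + w⁻¹) / 2) • u := by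
    rw [Matrix.sub_mulVec, Matrix.one_mulVec, Matrix.smul_mulVec,
      ← Matrix.mulVec_mulVec, hu, Matrix.mulVec_smul, hu, hwx, smul_smul, smul_smul, sub_smul,
      one_smul]
    congr 2
    ring
  have hfin := compression_aeval_mulVec hT1 conjTranspose_zeroIsometry_mul_self hT2 hT3 hw hgu
    (qspColumn G₀ Gs false)
  rw [← hfin, zeroBlock_eq_mul_ketOp 0, OracleCircuit.eval_qspCircuit_mul_ketOp U _ _ _
    (eval_walkCircuit_mul_ketOp_false hz hv hvk) (eval_walkCircuit_mul_ketOp_true hz hv hvk) G₀ Gs,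
    Matrix.mul_add, ← Matrix.mul_assoc _ (ketOp _ false), ← Matrix.mul_assoc _ (ketOp _ true),
    conjTranspose_zeroIsometry_mul_ketOp_false, conjTranspose_zeroIsometry_mul_ketOp_true,
    Matrix.zero_mul, add_zero]

end EigenvalueTransformation

/-! ### The filter polynomial -/

section FilterPolynomial

open Polynomial

/-- A point `w = e^{iφ}` of the unit circle with `x = cos (φ / 2)`. -/
theorem exists_norm_eq_one_of_abs_le_one {x : ℝ} (hx : |x| ≤ 1) :
    ∃ w : ℂ, ‖w‖ = 1 ∧ (w + w⁻¹) / 2 = 2 * (x : ℂ) ^ 2 - 1 ∧ ‖1 + w‖ = 2 * |x| := by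
  have hx2 : 0 ≤ 1 - x ^ 2 := by
    have := (sq_le_one_iff_abs_le_one x).2 hx
    linarith
  obtain ⟨y, hy⟩ : ∃ y, y = √(1 - x ^ 2) := ⟨_, rfl⟩
  have hxy : x ^ 2 + y ^ 2 = 1 := by rw [hy, Real.sq_sqrt hx2]; ring
  obtain ⟨w, hw⟩ : ∃ w : ℂ, w = ⟨2 * x ^ 2 - 1, 2 * x * y⟩ := ⟨_, rfl⟩
  have hw1 : ‖w‖ = 1 := by
    rw [← pow_eq_one_iff_of_nonneg (norm_nonneg _) two_ne_zero, Complex.sq_norm,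
      Complex.normSq_apply, hw]
    linear_combination 4 * x ^ 2 * hxy
  refine ⟨w, hw1, ?_, ?_⟩
  · rw [Complex.inv_eq_conj hw1, Complex.add_conj, hw]
    push_cast
    ring
  · rw [← sq_eq_sq₀ (norm_nonneg _) (by positivity), Complex.sq_norm, Complex.normSq_apply, mul_pow,
      sq_abs]
    simp only [Complex.add_re, Complex.add_im, Complex.one_re, Complex.one_im, hw]
    linear_combination 4 * x ^ 2 * hxy

/-- The filter: a power of the normalized Dirichlet kernel `(1 + (-z) + ⋯ + (-z) ^ (N - 1)) / N`,
which peaks at `z = -1`, damped by `1 - δ`. -/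
noncomputable def filterPoly (δ : ℝ) (N r : ℕ) : ℂ[X] :=
  C ((1 - δ : ℝ) : ℂ) * (C ((N : ℂ)⁻¹) * ∑ j ∈ Finset.range N, (-X) ^ j) ^ r

theorem natDegree_filterPoly_le (δ : ℝ) (N r : ℕ) : (filterPoly δ N r).natDegree ≤ r * N := by
  refine (natDegree_C_mul_le _ _).trans (natDegree_pow_le.trans (Nat.mul_le_mul_left r ?_))
  refine (natDegree_C_mul_le _ _).trans (natDegree_sum_le_of_forall_le _ _ fun j hj => ?_)
  refine natDegree_pow_le.trans ?_
  rw [natDegree_neg, natDegree_X, mul_one]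
  exact (Finset.mem_range.1 hj).le

theorem eval_filterPoly (δ : ℝ) (N r : ℕ) (z : ℂ) :
    (filterPoly δ N r).eval z =
      ((1 - δ : ℝ) : ℂ) * ((N : ℂ)⁻¹ * ∑ j ∈ Finset.range N, (-z) ^ j) ^ r := by
  simp [filterPoly, eval_finsetSum]

theorem eval_filterPoly_neg_one (δ : ℝ) {N : ℕ} (hN : N ≠ 0) (r : ℕ) :
    (filterPoly δ N r).eval (-1) = ((1 - δ : ℝ) : ℂ) := by
  have : (N : ℂ) ≠ 0 := Nat.cast_ne_zero.2 hN
  rw [eval_filterPoly]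
  simp [this]

theorem norm_eval_filterPoly_lt_one {δ : ℝ} (h0 : 0 < δ) (h1 : δ ≤ 1) {N : ℕ} (hN : N ≠ 0) (r : ℕ)
    {z : ℂ} (hz : ‖z‖ = 1) : ‖(filterPoly δ N r).eval z‖ < 1 := by
  have hN' : (0 : ℝ) < N := Nat.cast_pos.2 (Nat.pos_of_ne_zero hN)
  have hsum : ‖∑ j ∈ Finset.range N, (-z) ^ j‖ ≤ N := by
    refine (norm_sum_le _ _).trans ?_
    simp [hz]
  have hD : ‖(N : ℂ)⁻¹ * ∑ j ∈ Finset.range N, (-z) ^ j‖ ≤ 1 := by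
    rw [norm_mul, norm_inv, Complex.norm_natCast, inv_mul_le_one₀ hN']
    exact hsum
  rw [eval_filterPoly, norm_mul, Complex.norm_real, Real.norm_of_nonneg (by linarith), norm_pow]
  calc (1 - δ) * ‖(N : ℂ)⁻¹ * ∑ j ∈ Finset.range N, (-z) ^ j‖ ^ r ≤ (1 - δ) * 1 := by
        exact mul_le_mul_of_nonneg_left (pow_le_one₀ (norm_nonneg _) hD) (by linarith)
    _ < 1 := by linarith

/-- Away from `-1` the geometric sum in the Dirichlet kernel is at most `2 / ‖1 + z‖`. -/
theorem norm_eval_filterPoly_le {δ : ℝ} (h0 : 0 ≤ δ) (h1 : δ ≤ 1) {N : ℕ} (hN : N ≠ 0) (r : ℕ)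
    {z : ℂ} (hz : ‖z‖ = 1) (h : 4 ≤ N * ‖1 + z‖) :
    ‖(filterPoly δ N r).eval z‖ ≤ (1 / 2) ^ r := by
  have hN' : (0 : ℝ) < N := Nat.cast_pos.2 (Nat.pos_of_ne_zero hN)
  have hpos : 0 < ‖1 + z‖ := by
    by_contra h'
    have : ‖1 + z‖ = 0 := le_antisymm (not_lt.1 h') (norm_nonneg _)
    rw [this] at h
    norm_num at h
  have hgeom : (∑ j ∈ Finset.range N, (-z) ^ j) * (-z - 1) = (-z) ^ N - 1 := geom_sum_mul _ _
  have hnorm : ‖∑ j ∈ Finset.range N, (-z) ^ j‖ * ‖1 + z‖ ≤ 2 := by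
    have h2 : ‖(-z - 1 : ℂ)‖ = ‖1 + z‖ := by
      rw [← norm_neg]
      congr 1
      ring
    rw [← h2, ← norm_mul, hgeom]
    refine (norm_sub_le _ _).trans ?_
    rw [norm_pow, norm_neg, hz, one_pow, norm_one]
    norm_num
  have hD : ‖(N : ℂ)⁻¹ * ∑ j ∈ Finset.range N, (-z) ^ j‖ ≤ 1 / 2 := by
    rw [norm_mul, norm_inv, Complex.norm_natCast, inv_mul_le_iff₀ hN']
    refine le_of_mul_le_mul_right (hnorm.trans ?_) hpos
    linarith
  rw [eval_filterPoly, norm_mul, Complex.norm_real, Real.norm_of_nonneg (by linarith), norm_pow]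
  calc (1 - δ) * ‖(N : ℂ)⁻¹ * ∑ j ∈ Finset.range N, (-z) ^ j‖ ^ r ≤ 1 * (1 / 2) ^ r := by
        gcongr
        linarith
    _ = (1 / 2) ^ r := one_mul _

end FilterPolynomial

/-! ### Spectral estimates -/

section Spectral

open scoped Matrix.Norms.L2Operator

theorem norm_one_le_one (κ : Type) [Fintype κ] [DecidableEq κ] : ‖(1 : Matrix κ κ ℂ)‖ ≤ 1 := by
  rw [← Matrix.diagonal_one, Matrix.l2_opNorm_diagonal]
  exact (pi_norm_le_iff_of_nonneg zero_le_one).2 fun i => by simp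

theorem norm_le_one_of_isometry {ι κ : Type} [Fintype ι] [DecidableEq ι] [Fintype κ]
    [DecidableEq κ] {J : Matrix ι κ ℂ} (hJ : J.conjTranspose * J = 1) : ‖J‖ ≤ 1 := by
  have h := Matrix.l2_opNorm_conjTranspose_mul_self J
  rw [hJ] at h
  nlinarith [norm_nonneg J, norm_one_le_one κ]

theorem norm_zeroBlock_le_one {m n : ℕ} {U : QOp (Wires m n)}
    (hU : U ∈ Matrix.unitaryGroup (Wires m n → Bool) ℂ) : ‖zeroBlock U‖ ≤ 1 := by
  have hJ := norm_le_one_of_isometry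
    (conjTranspose_zeroIsometry_mul_self (m := m) (n := n))
  have hU1 : ‖U‖ ≤ 1 :=
    norm_le_one_of_isometry (Matrix.mem_unitaryGroup_iff'.1 hU)
  rw [zeroBlock_eq]
  calc _ ≤ ‖(zeroIsometry m n).conjTranspose * U‖ * ‖zeroIsometry m n‖ := Matrix.l2_opNorm_mul _ _
    _ ≤ ‖(zeroIsometry m n).conjTranspose‖ * ‖U‖ * ‖zeroIsometry m n‖ := by
        gcongr
        exact Matrix.l2_opNorm_mul _ _
    _ ≤ 1 * 1 * 1 := by
        rw [Matrix.l2_opNorm_conjTranspose]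
        gcongr
    _ = 1 := by norm_num

/-- An operator that is diagonal in an eigenbasis of a Hermitian operator is bounded by its largest
eigenvalue. -/
theorem norm_le_of_mulVec_eigenvectorBasis {ι : Type} [Fintype ι] [DecidableEq ι]
    {H : Matrix ι ι ℂ} (hH : H.IsHermitian) {A : Matrix ι ι ℂ} {c : ι → ℂ} {ε : ℝ} (hε : 0 ≤ ε)
    (hA : ∀ i, A.mulVec (hH.eigenvectorBasis i).ofLp = c i • (hH.eigenvectorBasis i).ofLp)
    (hc : ∀ i, ‖c i‖ ≤ ε) : ‖A‖ ≤ ε := by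
  obtain ⟨V, hV⟩ : ∃ V : Matrix ι ι ℂ, V = hH.eigenvectorUnitary := ⟨_, rfl⟩
  have hV1 : V.conjTranspose * V = 1 := by
    rw [hV]
    exact Matrix.mem_unitaryGroup_iff'.1 hH.eigenvectorUnitary.2
  have hV2 : V * V.conjTranspose = 1 := by
    rw [hV]
    exact Matrix.mem_unitaryGroup_iff.1 hH.eigenvectorUnitary.2
  have hAV : A * V = V * Matrix.diagonal c := by
    ext i j
    have := congrFun (hA j) i
    rw [Matrix.mul_diagonal, Matrix.mul_apply]
    simp only [Matrix.mulVec, dotProduct, Pi.smul_apply, smul_eq_mul] at this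
    simp only [hV, Matrix.IsHermitian.eigenvectorUnitary_apply]
    rw [this, mul_comm]
  have hA' : A = V * Matrix.diagonal c * V.conjTranspose := by
    rw [← hAV, Matrix.mul_assoc, hV2, Matrix.mul_one]
  have hn := norm_le_one_of_isometry hV1
  rw [hA']
  calc _ ≤ ‖V * Matrix.diagonal c‖ * ‖V.conjTranspose‖ := Matrix.l2_opNorm_mul _ _
    _ ≤ ‖V‖ * ‖Matrix.diagonal c‖ * ‖V.conjTranspose‖ := by
        gcongr
        exact Matrix.l2_opNorm_mul _ _
    _ ≤ 1 * ε * 1 := by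
        rw [Matrix.l2_opNorm_conjTranspose, Matrix.l2_opNorm_diagonal]
        gcongr
        exact (pi_norm_le_iff_of_nonneg hε).2 hc
    _ = ε := by ring

theorem spectralProjector_mulVec_of_eq {n : ℕ} {H : QOp (Fin n)} {μ : ℝ}
    {u : EuclideanSpace ℂ (Fin n → Bool)} (hu : H.mulVec u.ofLp = (μ : ℂ) • u.ofLp) :
    (spectralProjector H μ).mulVec u.ofLp = u.ofLp := by
  have h : u ∈ Module.End.eigenspace (Matrix.toEuclideanLin H) (μ : ℂ) := by
    rw [Module.End.mem_eigenspace_iff]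
    ext i
    exact congrFun hu i
  have h1 := Submodule.starProjection_eq_self_iff.2 h
  have h2 : Matrix.toEuclideanCLM (n := Fin n → Bool) (𝕜 := ℂ) (spectralProjector H μ) =
      (Module.End.eigenspace (Matrix.toEuclideanLin H) (μ : ℂ)).starProjection := by
    rw [spectralProjector, StarAlgEquiv.apply_symm_apply]
  rw [← h2] at h1
  exact congrArg WithLp.ofLp h1

theorem spectralProjector_mulVec_of_ne {n : ℕ} {H : QOp (Fin n)} (hH : H.IsHermitian) {μ ν : ℝ}
    (hne : ν ≠ μ) {u : EuclideanSpace ℂ (Fin n → Bool)}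
    (hu : H.mulVec u.ofLp = (ν : ℂ) • u.ofLp) :
    (spectralProjector H μ).mulVec u.ofLp = 0 := by
  have h : u ∈ Module.End.eigenspace (Matrix.toEuclideanLin H) (ν : ℂ) := by
    rw [Module.End.mem_eigenspace_iff]
    ext i
    exact congrFun hu i
  have horth := (Matrix.isSymmetric_toEuclideanLin_iff.2 hH).orthogonalFamily_eigenspaces.isOrtho
    (show (ν : ℂ) ≠ μ from fun h => hne (Complex.ofReal_injective h))
  have h1 : (Module.End.eigenspace (Matrix.toEuclideanLin H) (μ : ℂ)).starProjection u = 0 := by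
    rw [Submodule.starProjection_apply_eq_zero_iff]
    exact horth h
  have h2 : Matrix.toEuclideanCLM (n := Fin n → Bool) (𝕜 := ℂ) (spectralProjector H μ) =
      (Module.End.eigenspace (Matrix.toEuclideanLin H) (μ : ℂ)).starProjection := by
    rw [spectralProjector, StarAlgEquiv.apply_symm_apply]
  rw [← h2] at h1
  exact congrArg WithLp.ofLp h1

theorem abs_eigenvalue_le {n m : ℕ} {α : ℝ} (hα : 0 < α) {H : QOp (Fin n)} {U : QOp (Wires m n)}
    (hU : U ∈ Matrix.unitaryGroup (Wires m n → Bool) ℂ) (hUH : H = (α : ℂ) • zeroBlock U) {ν : ℝ}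
    (hν : ν ∈ spectrum ℝ H) : |ν| ≤ α := by
  have h1 : ‖H‖ ≤ α := by
    rw [hUH, norm_smul, Complex.norm_real, Real.norm_of_nonneg hα.le]
    exact mul_le_of_le_one_right hα.le (norm_zeroBlock_le_one hU)
  have h2 := spectrum.norm_le_norm_mul_of_mem hν
  rw [Real.norm_eq_abs] at h2
  nlinarith [norm_one_le_one (Fin n → Bool), norm_nonneg H]

theorem IsBlockEncoding.eq_smul_zeroBlock {n m : ℕ} {α : ℝ} {U : QOp (Wires m n)}
    {H : QOp (Fin n)} (h : IsBlockEncoding α m 0 U H) : H = (α : ℂ) • zeroBlock U :=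
  sub_eq_zero.1 (norm_le_zero_iff.1 h.2)

/-- If `μ` is the only eigenvalue of `H`, then the eigenprojection is the identity, and the empty
circuit block-encodes it. -/
theorem isBlockEncoding_nil {n m : ℕ} {κ : Type} (U : QOp κ) {H : QOp (Fin n)} (hH : H.IsHermitian)
    {μ ε : ℝ} (hε : 0 ≤ ε) (h : ∀ i, hH.eigenvalues i = μ) :
    IsBlockEncoding 1 m ε (OracleCircuit.eval U []) (spectralProjector H μ) := by
  refine ⟨one_mem _, norm_le_of_mulVec_eigenvectorBasis hH (c := fun _ => 0) hε (fun i => ?_)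
    fun _ => by simpa using hε⟩
  have hone : zeroBlock (1 : QOp (Wires m n)) = 1 := by
    rw [zeroBlock_eq, Matrix.mul_one, conjTranspose_zeroIsometry_mul_self]
  have hi := hH.mulVec_eigenvectorBasis i
  rw [h i] at hi
  rw [OracleCircuit.eval, hone, Complex.ofReal_one, one_smul, Matrix.sub_mulVec, Matrix.one_mulVec,
    spectralProjector_mulVec_of_eq hi, sub_self, zero_smul]

end Spectral

/-! ### Eigenstate filtering -/

section EigenstateFiltering

theorem exists_lcu_rotations {α : ℝ} (hα : 0 < α) (μ : ℝ) :
    ∃ G G' : Matrix.unitaryGroup Bool ℂ,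
      (G' : Matrix Bool Bool ℂ) false false * (G : Matrix Bool Bool ℂ) false false =
        ((-μ / (α + |μ|) : ℝ) : ℂ) ∧
      (G' : Matrix Bool Bool ℂ) false true * (G : Matrix Bool Bool ℂ) true false =
        ((α / (α + |μ|) : ℝ) : ℂ) := by
  have hs : 0 < α + |μ| := by positivity
  obtain ⟨p, hp⟩ : ∃ p, p = √(|μ| / (α + |μ|)) := ⟨_, rfl⟩
  obtain ⟨q, hq⟩ : ∃ q, q = √(α / (α + |μ|)) := ⟨_, rfl⟩
  have hp2 : p * p = |μ| / (α + |μ|) := by rw [hp, Real.mul_self_sqrt (by positivity)]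
  have hq2 : q * q = α / (α + |μ|) := by rw [hq, Real.mul_self_sqrt (by positivity)]
  have hpq : p * p + q * q = 1 := by rw [hp2, hq2]; field_simp; ring
  -- The sign of `-μ` goes into the second rotation, with either sign allowed for `μ = 0`.
  obtain ⟨s, hs1, hsμ⟩ : ∃ s : ℝ, s * s = 1 ∧ s * |μ| = -μ := by
    rcases le_total μ 0 with h | h
    · exact ⟨1, by norm_num, by rw [abs_of_nonpos h]; ring⟩
    · exact ⟨-1, by norm_num, by rw [abs_of_nonneg h]; ring⟩
  refine ⟨su2 p q ?_, su2 (s * p : ℝ) (-q : ℝ) ?_, ?_, ?_⟩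
  · rw [Complex.norm_real, Complex.norm_real, Real.norm_eq_abs, Real.norm_eq_abs, sq_abs, sq_abs]
    linear_combination hpq
  · rw [Complex.norm_real, Complex.norm_real, Real.norm_eq_abs, Real.norm_eq_abs, sq_abs, sq_abs]
    linear_combination hpq + p * p * hs1
  · simp only [su2, su2Matrix, Bool.false_eq_true, if_false]
    rw [← Complex.ofReal_mul, mul_assoc, hp2, ← mul_div_assoc, hsμ]
  · simp only [su2, su2Matrix, Bool.false_eq_true, if_false, if_true]
    rw [Complex.conj_ofReal, Complex.ofReal_neg, neg_neg, ← Complex.ofReal_mul, hq2]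

theorem exists_ancillaPhase (κ : Type) (m : ℕ) {n : ℕ} (hn : 0 < n) :
    ∃ z : OracleCircuit κ (Wires (m + 2) n), z.queryCount = 0 ∧ z.gateCount ≤ 26 * (m + 2) + 4 ∧
      ∀ U, OracleCircuit.eval U z = phaseOp ancillasZero := by
  have h := OracleCircuit.exists_nonePhase κ (Sum.inr ⟨0, hn⟩ : Wires (m + 2) n)
    (List.ofFn (n := m + 2) Sum.inl) (by simp) (by
      rw [List.nodup_cons, List.nodup_ofFn]
      exact ⟨by simp, Sum.inl_injective⟩)
  rwa [List.length_ofFn] at h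

theorem eigenvalues_eq_of_gap {n : ℕ} {H : QOp (Fin n)} (hH : H.IsHermitian) {α μ Δ : ℝ}
    (hbound : ∀ ν ∈ spectrum ℝ H, |ν| ≤ α) (hgap : IsGappedEigenvalue H μ Δ)
    (h : n = 0 ∨ 2 * α < Δ) (i : Fin n → Bool) : hH.eigenvalues i = μ := by
  have hi := hH.eigenvalues_mem_spectrum_real i
  rcases h with rfl | h
  · have hμ := hgap.1
    rw [hH.spectrum_real_eq_range_eigenvalues] at hμ
    obtain ⟨j, hj⟩ := hμ
    rw [← hj, Subsingleton.elim i j]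
  · by_contra hne
    have h1 := hgap.2 _ hi hne
    have h2 := hbound _ hi
    have h3 := hbound _ hgap.1
    have h4 := abs_sub (hH.eigenvalues i) μ
    linarith

/-- The error of the filter on an eigenvector: `δ` at the eigenvalue `μ` and `2 ^ (-r)` elsewhere. -/
theorem norm_filter_error_le {δ : ℝ} (h0 : 0 < δ) (h1 : δ ≤ 1) {N : ℕ} (hN : N ≠ 0) {r : ℕ} {x : ℝ}
    {w : ℂ} (hw : ‖w‖ = 1) (hwx : ‖1 + w‖ = 2 * |x|) :
    (x = 0 → ‖1 - ((filterPoly δ N r).eval w + (filterPoly δ N r).eval w⁻¹) / 2‖ ≤ δ) ∧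
    (2 ≤ N * |x| →
      ‖0 - ((filterPoly δ N r).eval w + (filterPoly δ N r).eval w⁻¹) / 2‖ ≤ (1 / 2) ^ r) := by
  refine ⟨fun hx => ?_, fun hx => ?_⟩
  · rw [hx, abs_zero, mul_zero, norm_eq_zero] at hwx
    have hw' : w = -1 := by linear_combination hwx
    rw [hw', inv_neg, inv_one, eval_filterPoly_neg_one δ hN]
    have : (1 : ℂ) - (((1 - δ : ℝ) : ℂ) + ((1 - δ : ℝ) : ℂ)) / 2 = (δ : ℝ) := by
      push_cast
      ring
    rw [this, Complex.norm_real, Real.norm_of_nonneg h0.le]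
  · have hwi : ‖w⁻¹‖ = 1 := by rw [norm_inv, hw, inv_one]
    have hwx' : ‖1 + w⁻¹‖ = 2 * |x| := by
      rw [Complex.inv_eq_conj hw, ← map_one (starRingEnd ℂ), ← map_add, RCLike.norm_conj, hwx]
    have e1 := norm_eval_filterPoly_le h0.le h1 hN r hw (by rw [hwx]; linarith)
    have e2 := norm_eval_filterPoly_le h0.le h1 hN r hwi (by rw [hwx']; linarith)
    rw [zero_sub, norm_neg, norm_div, Complex.norm_ofNat]
    have := norm_add_le ((filterPoly δ N r).eval w) ((filterPoly δ N r).eval w⁻¹)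
    linarith

/-- The filtering circuit, with its costs in terms of the parameters `N` and `r` of the filter
polynomial. The linear combination of unitaries encodes `(H - μ) / (α + |μ|)`, and a gap `Δ` of `H`
becomes a gap at least `Δ / (2 α)` at zero. -/
theorem exists_filterCircuit {n : ℕ} (hn : 0 < n) (m : ℕ) {α μ Δ δ ε : ℝ} (hα : 0 < α) (hΔ : 0 < Δ)
    (hδ : 0 < δ) (hδ1 : δ ≤ 1) (hδε : δ ≤ ε) {N r : ℕ} (hN : N ≠ 0) (hNΔ : 4 * α / Δ ≤ N)
    (hr : (1 / 2) ^ r ≤ ε) :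
    ∃ c : OracleCircuit (Wires m n) (Wires (m + 2) n), c.queryCount = 2 * (r * N) ∧
      c.gateCount ≤ r * N * (117 * (m + 1)) + 1 ∧
      ∀ (H : QOp (Fin n)) (U : QOp (Wires m n)),
        H.IsHermitian → IsBlockEncoding α m 0 U H → IsGappedEigenvalue H μ Δ →
          IsBlockEncoding 1 (m + 2) ε (c.eval U) (spectralProjector H μ) := by
  have hp := natDegree_filterPoly_le δ N r
  obtain ⟨q, hq, hpq⟩ := Polynomial.exists_complement hp fun z hz =>
    norm_eval_filterPoly_lt_one hδ hδ1 hN r hz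
  obtain ⟨G₀, Gs, hlen, hcol, -⟩ := exists_qspColumn_eq _ _ _ hp hq hpq
  obtain ⟨G, G', hG1, hG2⟩ := exists_lcu_rotations hα μ
  obtain ⟨z, hzq, hzg, hz⟩ := exists_ancillaPhase (Wires m n) m hn
  have hvq : (lcuCircuit m n G G').queryCount = 1 := rfl
  have hvg : (lcuCircuit m n G G').gateCount = 2 := rfl
  refine ⟨OracleCircuit.qspCircuit (Sum.inl 0) (walkCircuit (lcuCircuit m n G G') z) G₀ Gs,
    ?_, ?_, fun H U hH hU hgap => ?_⟩
  · rw [OracleCircuit.queryCount_qspCircuit, hlen, walkCircuit]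
    simp only [OracleCircuit.queryCount_append, OracleCircuit.queryCount_inverse, hvq, hzq]
    ring
  · rw [OracleCircuit.gateCount_qspCircuit, hlen, walkCircuit]
    simp only [OracleCircuit.gateCount_append, OracleCircuit.gateCount_inverse, hvg]
    -- Per step: one rotation, four gates around the two queries, and two reflections.
    gcongr
    omega
  · have hUH : H = (α : ℂ) • zeroBlock U := hU.eq_smul_zeroBlock
    have hbound : ∀ ν ∈ spectrum ℝ H, |ν| ≤ α := fun ν hν => abs_eigenvalue_le hα hU.1 hUH hν
    have hs : 0 < α + |μ| := by positivity
    have hsC : ((α + |μ| : ℝ) : ℂ) ≠ 0 := Complex.ofReal_ne_zero.2 hs.ne'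
    have hblock : zeroBlock (OracleCircuit.eval U (lcuCircuit m n G G')) =
        ((-μ / (α + |μ|) : ℝ) : ℂ) • 1 + ((1 / (α + |μ|) : ℝ) : ℂ) • H := by
      rw [zeroBlock_eval_lcuCircuit, hG1, hG2, hUH, smul_smul, ← Complex.ofReal_mul,
        one_div_mul_eq_div]
    have hherm : (zeroBlock (OracleCircuit.eval U (lcuCircuit m n G G'))).IsHermitian := by
      rw [hblock]
      refine Matrix.IsHermitian.add ?_ ?_
      · rw [Matrix.IsHermitian, Matrix.conjTranspose_smul, Matrix.conjTranspose_one]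
        simp [Complex.conj_ofReal]
      · rw [Matrix.IsHermitian, Matrix.conjTranspose_smul, hH.eq]
        simp [Complex.conj_ofReal]
    have hx (i : Fin n → Bool) : ∃ w : ℂ, ‖w‖ = 1 ∧
        (w + w⁻¹) / 2 = 2 * ((((hH.eigenvalues i - μ) / (α + |μ|) : ℝ)) : ℂ) ^ 2 - 1 ∧
        ‖1 + w‖ = 2 * |(hH.eigenvalues i - μ) / (α + |μ|)| := by
      refine exists_norm_eq_one_of_abs_le_one ?_
      rw [abs_div, abs_of_pos hs, div_le_one hs]
      exact (abs_sub _ _).trans (by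
        have := hbound _ (hH.eigenvalues_mem_spectrum_real i)
        linarith)
    choose w hw1 hw2 hw3 using hx
    refine ⟨OracleCircuit.eval_mem_unitaryGroup hU.1 _, norm_le_of_mulVec_eigenvectorBasis hH
      (c := fun i => (if hH.eigenvalues i = μ then 1 else 0) -
        ((filterPoly δ N r).eval (w i) + (filterPoly δ N r).eval (w i)⁻¹) / 2)
      (hδ.le.trans hδε) (fun i => ?_) fun i => ?_⟩
    · have hi := hH.mulVec_eigenvectorBasis i
      have hP : (spectralProjector H μ).mulVec (hH.eigenvectorBasis i).ofLp =
          (if hH.eigenvalues i = μ then (1 : ℂ) else 0) • (hH.eigenvectorBasis i).ofLp := by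
        split_ifs with h
        · rw [h] at hi
          rw [spectralProjector_mulVec_of_eq hi, one_smul]
        · rw [spectralProjector_mulVec_of_ne hH h hi, zero_smul]
      have hu : (zeroBlock (OracleCircuit.eval U (lcuCircuit m n G G'))).mulVec
          (hH.eigenvectorBasis i).ofLp =
          (((hH.eigenvalues i - μ) / (α + |μ|) : ℝ) : ℂ) • (hH.eigenvectorBasis i).ofLp := by
        have hi' : H.mulVec (hH.eigenvectorBasis i).ofLp =
          ((hH.eigenvalues i : ℝ) : ℂ) • (hH.eigenvectorBasis i).ofLp := hi
        rw [hblock, Matrix.add_mulVec, Matrix.smul_mulVec, Matrix.smul_mulVec, Matrix.one_mulVec,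
          hi', smul_smul, ← add_smul]
        congr 1
        rw [← Complex.ofReal_mul, ← Complex.ofReal_add]
        congr 1
        field_simp
        ring
      have hF := zeroBlock_eval_qspCircuit_mulVec U (hz U)
        (OracleCircuit.eval_mem_unitaryGroup hU.1 _) (commute_ketOp_eval_lcuCircuit U G G') hherm
        (norm_ne_zero_iff.1 (by rw [hw1 i]; exact one_ne_zero)) (hw2 i) hu G₀ Gs
      rw [hcol] at hF
      rw [Complex.ofReal_one, one_smul, Matrix.sub_mulVec, hP, hF, ← sub_smul]
    · have herr := norm_filter_error_le hδ hδ1 hN (r := r) (hw1 i) (hw3 i)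
      by_cases h : hH.eigenvalues i = μ
      · rw [if_pos h]
        exact (herr.1 (by rw [h, sub_self, zero_div])).trans hδε
      · rw [if_neg h]
        refine (herr.2 ?_).trans hr
        have h1 := hgap.2 _ (hH.eigenvalues_mem_spectrum_real i) h
        have h2 := hbound _ hgap.1
        rw [abs_div, abs_of_pos hs, ← mul_div_assoc, le_div_iff₀ hs]
        calc 2 * (α + |μ|) ≤ 4 * α / Δ * Δ := by
              rw [div_mul_cancel₀ _ hΔ.ne']
              linarith
          _ ≤ N * |hH.eigenvalues i - μ| := by gcongr

end EigenstateFiltering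

theorem theorem2 :
    ∃ C : ℝ, 0 < C ∧
      ∀ (n m : ℕ) (α μ Δ ε : ℝ), 0 < α → 0 < Δ → 0 < ε → ε ≤ 1 / 2 →
        ∃ c : OracleCircuit (Wires m n) (Wires (m + 2) n),
          (c.queryCount : ℝ) ≤ C * ((α / Δ) * Real.log (1 / ε)) ∧
          (c.gateCount : ℝ) ≤ C * (((m + 1) * α / Δ) * Real.log (1 / ε)) ∧
          ∀ (H : QOp (Fin n)) (U : QOp (Wires m n)),
            H.IsHermitian → IsBlockEncoding α m 0 U H → IsGappedEigenvalue H μ Δ →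
              IsBlockEncoding 1 (m + 2) ε (c.eval U) (spectralProjector H μ) := by
  refine ⟨118 * 18, by norm_num, fun n m α μ Δ ε hα hΔ hε hε2 => ?_⟩
  have hlog2 := Real.log_two_gt_d9
  have hL : Real.log 2 ≤ Real.log (1 / ε) := by
    refine Real.log_le_log two_pos ?_
    rw [le_div_iff₀ hε]
    linarith
  obtain ⟨L, hLdef⟩ : ∃ L, L = Real.log (1 / ε) := ⟨_, rfl⟩
  rw [← hLdef] at hL ⊢
  have hL0 : 0 < L := by linarith
  -- Without a borrowed system qubit, or if the gap exceeds the diameter `2 α` of the spectrum, `μ`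
  -- is the only eigenvalue. Otherwise `α / Δ ≥ 1 / 2`, and the bounds leave room for rounding.
  by_cases hcase : n = 0 ∨ 2 * α < Δ
  · refine ⟨[], ?_, ?_, fun H U hH hU hgap => isBlockEncoding_nil U hH hε.le
      (eigenvalues_eq_of_gap hH (fun ν hν => abs_eigenvalue_le hα hU.1
        hU.eq_smul_zeroBlock hν) hgap hcase)⟩
    · simp only [OracleCircuit.queryCount, List.countP_nil, Nat.cast_zero]
      positivity
    · simp only [OracleCircuit.gateCount, List.countP_nil, Nat.cast_zero]
      positivity
  · rw [not_or, not_lt] at hcase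
    obtain ⟨k, hk⟩ : ∃ k, k = α / Δ := ⟨_, rfl⟩
    have hk2 : 1 / 2 ≤ k := by
      rw [hk, le_div_iff₀ hΔ]
      linarith [hcase.2]
    obtain ⟨N, hNdef⟩ : ∃ N, N = ⌈4 * k⌉₊ := ⟨_, rfl⟩
    obtain ⟨r, hrdef⟩ : ∃ r, r = ⌈L / Real.log 2⌉₊ := ⟨_, rfl⟩
    have hN1 : 4 * k ≤ N := hNdef ▸ Nat.le_ceil _
    have hN2 : (N : ℝ) ≤ 6 * k := by
      have := Nat.ceil_lt_add_one (show 0 ≤ 4 * k by linarith)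
      rw [← hNdef] at this
      linarith
    have hr1 : L ≤ r * Real.log 2 := by
      rw [← div_le_iff₀ (by linarith)]
      exact hrdef ▸ Nat.le_ceil _
    have hr2 : (r : ℝ) ≤ 3 * L := by
      have h := Nat.ceil_lt_add_one (show 0 ≤ L / Real.log 2 by positivity)
      rw [← hrdef] at h
      have h1 : L / Real.log 2 ≤ 3 / 2 * L := by
        rw [div_le_iff₀ (by linarith)]
        nlinarith
      linarith
    have hN0 : N ≠ 0 := by
      rintro rfl
      rw [Nat.cast_zero] at hN1
      linarith
    have hr0 : r ≠ 0 := by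
      rintro rfl
      rw [Nat.cast_zero, zero_mul] at hr1
      linarith
    have hrε : (1 / 2 : ℝ) ^ r ≤ ε := by
      rw [← Real.log_le_log_iff (by positivity) hε, Real.log_pow, one_div, Real.log_inv]
      rw [hLdef, one_div, Real.log_inv] at hr1
      linarith
    have hrN : ((r * N : ℕ) : ℝ) ≤ 18 * (k * L) := by
      push_cast
      calc (r : ℝ) * N ≤ 3 * L * (6 * k) := by gcongr
        _ = 18 * (k * L) := by ring
    obtain ⟨c, hcq, hcg, hc⟩ := exists_filterCircuit (Nat.pos_of_ne_zero hcase.1) m (μ := μ) hα hΔ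
      (half_pos hε) (by linarith) (half_le_self hε.le) hN0
      (by rwa [mul_div_assoc, ← hk]) hrε
    refine ⟨c, ?_, ?_, hc⟩
    · rw [hcq, ← hk]
      push_cast at hrN ⊢
      have : 0 < k * L := by positivity
      linarith
    · have h1 : 1 ≤ r * N := Nat.mul_pos (Nat.pos_of_ne_zero hr0) (Nat.pos_of_ne_zero hN0)
      have h2 : c.gateCount ≤ r * N * (118 * (m + 1)) := by nlinarith
      calc (c.gateCount : ℝ) ≤ ((r * N : ℕ) : ℝ) * (118 * (m + 1)) := by exact_mod_cast h2
        _ ≤ 18 * (k * L) * (118 * (m + 1)) := by gcongr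
        _ = 118 * 18 * ((m + 1) * α / Δ * L) := by
            rw [hk]
            ring
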